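/- Let $H$ be a set of functions $g:\mathbb R\to\mathbb R$ with period $1$ which is invariant under the shifts $\theta_c g(x)=g(x+c)$, $c\in\mathbb R$, equipped with its cylindrical $\sigma$-field. An *intrinsic location functional* on $H$ is a map $L$ assigning to $g\in H$ and a compact interval $I=[a,b]$, $a<b$, a value $L(g,I)\in\mathbb R\cup\{\infty\}$ such that: (1) $L(\cdot,I)$ is measurable for each $I$; (2) $L(g,I)\in I\cup\{\infty\}$; (3) $L(g,I)=L(\theta_c g,I-c)+c$ for all $c\in\mathbb R$ (with $\infty+c=\infty$); (4) if $I_2\subseteq I_1$ and $L(g,I_1)\in I_2$, then $L(g,I_2)=L(g,I_1)$; (5) if $I_2\subseteq I_1$ and $L(g,I_2)\ne\infty$, then $L(g,I_1)\neq\infty$. It is *invariant* if moreover $L(g,I)\ne\infty$ for all $g$ and $I$, and $L(g,[0,1])\equiv L(g,[a,a+1]) \pmod 1$ for all $a\in\mathbb R$ and $g\in H$. **Proposition.** Let $T\in(0,1]$. (i) Let $H$ be as above, let $L$ be an invariant intrinsic location functional on $H$, and let $\mathbf X$ be a stationary process with càdlàg (for instance, continuous) paths, all belonging to $H$ (so that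 $\mathbf X$ has period $1$). Then the law of $L(\mathbf X,[0,T])$ is absolutely continuous on $(0,T)$ with a càdlàg density, and this density $f=f^{\mathbf X}_{L,T}$ satisfies $$f(t)\le \max\left(\left\lfloor\frac{1-T}{t}\right\rfloor,\left\lfloor\frac{1-T}{T-t}\right\rfloor\right)+2\qquad\text{for all } t\in(0,T).$$ (ii) For every $t\in(0,\frac T2)$ such that $\frac{1-T}{t}$ is not an integer, and every $t\in[\frac T2,T)$ such that $\frac{1-T}{T-t}$ is not an integer, there exist such a set $H$, an invariant intrinsic location functional $L$ on $H$, and a stationary process $\mathbf X$ with continuous paths belonging to $H$, for which equality holds in (i) at $t$. (iii) For all $t\in(0,T)$, $$\max\left(\left\lfloor\frac{1-T}{t}\right\rfloor,\left\lfloor\frac{1-T}{T-t}\right\rfloor\right)+2\le\max\left(\frac1t,\frac1{T-t}\right),$$ where the right-hand side is the bound known for general (not necessarily periodic) stationary processes and general intrinsic location functionals. -/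

import Mathlib

open Set Filter Topology MeasureTheory

/-- `f` is càdlàg on `s` (used for `s` open): at every point of `s` it is right-continuous and has
a (finite) left limit. -/
def IsCadlagOn (f : ℝ → ℝ) (s : Set ℝ) : Prop :=
  ∀ t ∈ s, ContinuousWithinAt f (Ici t) t ∧ ∃ l : ℝ, Tendsto f (𝓝[<] t) (𝓝 l)

/-- A set `H` of functions on `ℝ` with period `1`, invariant under all shifts
`θ_c g (x) = g (x + c)`. -/
structure PathClass where
  carrier : Set (ℝ → ℝ)
  periodic : ∀ g ∈ carrier, Function.Periodic g 1
  shift_mem : ∀ g ∈ carrier, ∀ c : ℝ, (fun x => g (x + c)) ∈ carrier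

namespace PathClass

/-- The functions in `H`, as a type. Its `σ`-field (found by instance search) is the cylindrical
one: the trace on `H` of the product `σ`-field of `ℝ → ℝ`. -/
abbrev Path (H : PathClass) : Type := {g : ℝ → ℝ // g ∈ H.carrier}

/-- The shift `θ_c g (x) = g (x + c)` on `H`. -/
def shift (H : PathClass) (c : ℝ) (g : H.Path) : H.Path :=
  ⟨fun x => g.1 (x + c), H.shift_mem g.1 g.2 c⟩

end PathClass

/-- An intrinsic location functional on `H`. The interval `[a, b]`, `a < b`, is given by its
endpoints; `L g a b` has no meaning for `b ≤ a`. The value `∞` is `⊤ : WithTop ℝ`. -/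
structure IsIntrinsicLocation (H : PathClass) (L : H.Path → ℝ → ℝ → WithTop ℝ) : Prop where
  measurable : ∀ a b : ℝ, a < b → Measurable fun g => L g a b
  mem_or_top : ∀ (g : H.Path) (a b : ℝ), a < b →
    L g a b = ⊤ ∨ ∃ x ∈ Icc a b, L g a b = (x : WithTop ℝ)
  shift_compat : ∀ (g : H.Path) (a b c : ℝ), a < b →
    L g a b = L (H.shift c g) (a - c) (b - c) + (c : WithTop ℝ)
  stable : ∀ (g : H.Path) (a₁ b₁ a₂ b₂ : ℝ), a₂ < b₂ → a₁ ≤ a₂ → b₂ ≤ b₁ →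
    (∃ x ∈ Icc a₂ b₂, L g a₁ b₁ = (x : WithTop ℝ)) → L g a₂ b₂ = L g a₁ b₁
  exist_consistent : ∀ (g : H.Path) (a₁ b₁ a₂ b₂ : ℝ), a₂ < b₂ → a₁ ≤ a₂ → b₂ ≤ b₁ →
    L g a₂ b₂ ≠ ⊤ → L g a₁ b₁ ≠ ⊤

/-- An invariant intrinsic location functional: it is never `∞`, and
`L(g, [0,1]) = L(g, [a, a+1]) mod 1` for every `a`. -/
structure IsInvariantLocation (H : PathClass) (L : H.Path → ℝ → ℝ → WithTop ℝ) : Prop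
    extends IsIntrinsicLocation H L where
  ne_top : ∀ (g : H.Path) (a b : ℝ), a < b → L g a b ≠ ⊤
  mod_one : ∀ (g : H.Path) (a : ℝ),
    ∃ n : ℤ, L g a (a + 1) = L g 0 1 + ((n : ℝ) : WithTop ℝ)

/-- `X` is a stationary process whose paths lie in `H` (hence have period `1`): it is measurable,
and every shifted process `X(· + c)` has the same law on path space as `X`. -/
structure IsStationaryProcess {Ω : Type*} [MeasurableSpace Ω] (μ : Measure Ω) (H : PathClass)
    (X : Ω → H.Path) : Prop where
  measurable : Measurable X
  stationary : ∀ c : ℝ,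
    μ.map (fun ω => (fun t : ℝ => (X ω).1 (t + c))) = μ.map (fun ω => (X ω).1)

/-- The law of `L(X, [0,T])`, a measure on `ℝ ∪ {∞}`. -/
noncomputable def locationLaw {Ω : Type*} [MeasurableSpace Ω] (μ : Measure Ω) {H : PathClass}
    (L : H.Path → ℝ → ℝ → WithTop ℝ) (X : Ω → H.Path) (T : ℝ) : Measure (WithTop ℝ) :=
  μ.map fun ω => L (X ω) 0 T

/-- On the open interval `(0, T)` the measure `ν` is absolutely continuous with the nonnegative
càdlàg density `f` (the values of `f` off `(0, T)` are irrelevant). -/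
structure IsCadlagDensity (ν : Measure (WithTop ℝ)) (T : ℝ) (f : ℝ → ℝ) : Prop where
  nonneg : ∀ t ∈ Ioo 0 T, 0 ≤ f t
  cadlag : IsCadlagOn f (Ioo 0 T)
  density : ∀ B : Set ℝ, MeasurableSet B → B ⊆ Ioo 0 T →
    ν ((fun x : ℝ => (x : WithTop ℝ)) '' B) = ∫⁻ s in B, ENNReal.ofReal (f s)

/-- The bound `max (⌊(1 - T) / t⌋, ⌊(1 - T) / (T - t)⌋) + 2`. -/
noncomputable def invariantBound (T t : ℝ) : ℝ :=
  ((max ⌊(1 - T) / t⌋ ⌊(1 - T) / (T - t)⌋ : ℤ) : ℝ) + 2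

/-! Upper bound: put the windows `[kδ, kδ + T]`, with `δ = 1/N`, around the circle. By stationarity
`N · P(L ∈ (t, t + δ])` is the expected number of windows whose location has relative position in
`(t, t + δ]`. This number is bounded path by path (`card_windows_le`). Let `ρ` be the location of
`[0, 1]`. A window with a translate of `ρ` in its interior has that translate as location
(`eq_root`), and at most one good window is located on `ρ + ℤ`. Any other good window starts, modulo
1, within `1 - T` after `ρ`, and by `gap` two such starts are more than about `min t (T - t)` apart.
This gives `⌊(1 - T) / min t (T - t)⌋ + 1` windows, plus the one on `ρ + ℤ`.

Càdlàg density: a cruder use of the same count makes the distribution function locally Lipschitz.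
Its difference quotients have uniformly bounded variation: moving an interval `(x, y]` by `h`
changes its probability only through paths whose location jumps when a window end moves by `h`, and
about `1/h` shifts of such a jump event are disjoint. Hence the derivative has locally bounded
variation along the differentiability points, and its right limits are the density.

Sharpness: take a cosine with uniform phase, and let `L` be the leftmost point of highest priority
among `n + 2` marked points of the circle, `n = ⌊(1 - T) / min t (T - t)⌋`, and their translates. If
consecutive points are slightly more than `min t (T - t)` apart, each point contributes mass `δ` to
`(t, t + δ]`. There is room for them exactly because the ratio is not an integer. -/

/-! ### Càdlàg densities from distribution functions -/

theorem MonotoneOn.exists_tendsto_right {p : ℝ → ℝ} {D : Set ℝ} {t : ℝ} (hp : MonotoneOn p D)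
    (hc : ∃ c ∈ D, c ≤ t) : ∃ l, Tendsto p (𝓝[D ∩ Ioi t] t) (𝓝 l) := by
  rcases (D ∩ Ioi t).eq_empty_or_nonempty with h | hne
  · exact ⟨0, by simp [h]⟩
  obtain ⟨c, hcD, hct⟩ := hc
  have hb : BddBelow (p '' (D ∩ Ioi t)) := by
    refine ⟨p c, ?_⟩
    rintro _ ⟨x, hx, rfl⟩
    exact hp hcD hx.1 (hct.trans (le_of_lt hx.2))
  refine ⟨sInf (p '' (D ∩ Ioi t)), tendsto_order.2 ⟨fun a ha => ?_, fun a ha => ?_⟩⟩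
  · filter_upwards [self_mem_nhdsWithin] with x hx
    exact ha.trans_le (csInf_le hb ⟨x, hx, rfl⟩)
  · obtain ⟨_, ⟨y, hy, rfl⟩, hya⟩ := exists_lt_of_csInf_lt (hne.image p) ha
    filter_upwards [self_mem_nhdsWithin, mem_nhdsWithin_of_mem_nhds (Iio_mem_nhds hy.2)] with x hx hxy
    exact (hp hx.1 hy.1 (le_of_lt hxy)).trans_lt hya

theorem MonotoneOn.exists_tendsto_left {p : ℝ → ℝ} {D : Set ℝ} {t : ℝ} (hp : MonotoneOn p D)
    (hc : ∃ c ∈ D, t ≤ c) : ∃ l, Tendsto p (𝓝[D ∩ Iio t] t) (𝓝 l) := by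
  rcases (D ∩ Iio t).eq_empty_or_nonempty with h | hne
  · exact ⟨0, by simp [h]⟩
  obtain ⟨c, hcD, hct⟩ := hc
  have hb : BddAbove (p '' (D ∩ Iio t)) := by
    refine ⟨p c, ?_⟩
    rintro _ ⟨x, hx, rfl⟩
    exact hp hx.1 hcD ((le_of_lt hx.2).trans hct)
  refine ⟨sSup (p '' (D ∩ Iio t)), tendsto_order.2 ⟨fun a ha => ?_, fun a ha => ?_⟩⟩
  · obtain ⟨_, ⟨y, hy, rfl⟩, hya⟩ := exists_lt_of_lt_csSup (hne.image p) ha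
    filter_upwards [self_mem_nhdsWithin, mem_nhdsWithin_of_mem_nhds (Ioi_mem_nhds hy.2)] with x hx hxy
    exact hya.trans_le (hp hy.1 hx.1 (le_of_lt hxy))
  · filter_upwards [self_mem_nhdsWithin] with x hx
    exact (le_csSup hb ⟨x, hx, rfl⟩).trans_lt ha

theorem nhdsWithin_inter_Ioi_neBot {D : Set ℝ} {t T : ℝ}
    (hD : ∀ a b, 0 < a → a < b → b < T → ∃ d ∈ D, a < d ∧ d < b) (ht : t ∈ Ioo 0 T) :
    (𝓝[D ∩ Ioi t] t).NeBot := by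
  rw [← mem_closure_iff_nhdsWithin_neBot, Metric.mem_closure_iff]
  intro ε hε
  obtain ⟨d, hdD, h1, h2⟩ := hD t (min (t + ε) ((t + T) / 2)) ht.1
    (lt_min (by linarith) (by linarith [ht.2])) ((min_le_right _ _).trans_lt (by linarith [ht.2]))
  refine ⟨d, ⟨hdD, h1⟩, ?_⟩
  rw [Real.dist_eq, abs_sub_comm, abs_of_pos (by linarith)]
  linarith [h2.trans_le (min_le_left _ _)]

/-- A function with one-sided limits along a dense set is càdlàg after regularization. -/
theorem isCadlagOn_of_tendsto_right {f r : ℝ → ℝ} {D : Set ℝ} {T : ℝ}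
    (hD : ∀ a b, 0 < a → a < b → b < T → ∃ d ∈ D, a < d ∧ d < b)
    (hr : ∀ t ∈ Ioo 0 T, Tendsto f (𝓝[D ∩ Ioi t] t) (𝓝 (r t)))
    (hl : ∀ t ∈ Ioo 0 T, ∃ l, Tendsto f (𝓝[D ∩ Iio t] t) (𝓝 l)) :
    IsCadlagOn r (Ioo 0 T) := by
  have hne : ∀ t ∈ Ioo 0 T, (𝓝[D ∩ Ioi t] t).NeBot := fun t ht =>
    nhdsWithin_inter_Ioi_neBot hD ht
  intro t ht
  constructor
  · rw [← continuousWithinAt_Ioi_iff_Ici, ContinuousWithinAt, Metric.tendsto_nhds]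
    intro ε hε
    have h1 := (Metric.tendsto_nhds.1 (hr t ht)) (ε / 2) (by linarith)
    rw [eventually_nhdsWithin_iff, Metric.eventually_nhds_iff] at h1
    obtain ⟨η, hη, h1⟩ := h1
    filter_upwards [Ioo_mem_nhdsGT (show t < min (t + η) T from lt_min (by linarith) ht.2)] with s hs
    have hsT : s ∈ Ioo 0 T := ⟨ht.1.trans hs.1, hs.2.trans_le (min_le_right _ _)⟩
    have := hne s hsT
    have h2 : dist (r s) (r t) ≤ ε / 2 := by
      refine le_of_tendsto ((hr s hsT).dist tendsto_const_nhds) ?_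
      filter_upwards [self_mem_nhdsWithin, mem_nhdsWithin_of_mem_nhds (Iio_mem_nhds hs.2)]
        with x hx hx2
      refine (h1 ?_ ⟨hx.1, hs.1.trans hx.2⟩).le
      have h3 : s < x := hx.2
      rw [Real.dist_eq, abs_of_pos (by linarith [hs.1])]
      linarith [(show x < _ from hx2).trans_le (min_le_left _ _)]
    linarith
  · obtain ⟨l, hl⟩ := hl t ht
    refine ⟨l, Metric.tendsto_nhds.2 fun ε hε => ?_⟩
    have h1 := (Metric.tendsto_nhds.1 hl) (ε / 2) (by linarith)
    rw [eventually_nhdsWithin_iff, Metric.eventually_nhds_iff] at h1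
    obtain ⟨η, hη, h1⟩ := h1
    filter_upwards [Ioo_mem_nhdsLT (show max (t - η) 0 < t from max_lt (by linarith) ht.1)] with s hs
    have hsT : s ∈ Ioo 0 T := ⟨(le_max_right _ _).trans_lt hs.1, hs.2.trans ht.2⟩
    have := hne s hsT
    have h2 : dist (r s) l ≤ ε / 2 := by
      refine le_of_tendsto ((hr s hsT).dist tendsto_const_nhds) ?_
      filter_upwards [self_mem_nhdsWithin, mem_nhdsWithin_of_mem_nhds (Iio_mem_nhds hs.2)]
        with x hx hx2
      refine (h1 ?_ ⟨hx.1, hx2⟩).le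
      have h3 : s < x := hx.2
      have h4 : x < t := hx2
      rw [Real.dist_eq, abs_sub_comm, abs_of_pos (by linarith [hs.1])]
      linarith [(le_max_left (t - η) 0).trans_lt hs.1]
    linarith

/-- A monotone function whose difference quotients have uniformly bounded variation, locally in
`(0, T)`, has almost everywhere a nonnegative càdlàg derivative there. -/
theorem exists_cadlag_ae_eq_deriv {F : ℝ → ℝ} {T : ℝ} (hF : Monotone F)
    (hvar : ∀ a b, 0 < a → a < b → b < T → ∃ C : NNReal, ∀ᶠ h in 𝓝[>] (0 : ℝ),
      eVariationOn (fun x => (F (x + h) - F x) / h) (Icc a b) ≤ C) :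
    ∃ f : ℝ → ℝ, IsCadlagOn f (Ioo 0 T) ∧ (∀ t ∈ Ioo 0 T, 0 ≤ f t) ∧
      ∀ᵐ x, x ∈ Ioo 0 T → f x = deriv F x := by
  set D : Set ℝ := {x | x ∈ Ioo 0 T ∧ DifferentiableAt ℝ F x} with hDdef
  have hae : ∀ᵐ x, x ∈ Ioo 0 T → x ∈ D := by
    filter_upwards [hF.ae_differentiableAt] with x hx hx2 using ⟨hx2, hx⟩
  have hD : ∀ a b, 0 < a → a < b → b < T → ∃ d ∈ D, a < d ∧ d < b := by
    intro a b ha hab hb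
    have h1 : (volume.restrict (Ioo a b)) ≠ 0 := by
      rw [Ne, Measure.restrict_eq_zero]; simp [hab]
    have : (ae (volume.restrict (Ioo a b))).NeBot := ae_neBot.2 h1
    obtain ⟨d, h2, h3⟩ := ((ae_restrict_of_ae hae).and
      (ae_restrict_mem (measurableSet_Ioo (a := a) (b := b)))).exists
    exact ⟨d, h2 ⟨ha.trans h3.1, h3.2.trans hb⟩, h3.1, h3.2⟩
  have hlim : ∀ x ∈ D, Tendsto (fun h => (F (x + h) - F x) / h) (𝓝[>] (0 : ℝ))
      (𝓝 (deriv F x)) := by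
    intro x hx
    have h1 := (hasDerivAt_iff_tendsto_slope_zero.1 hx.2.hasDerivAt).mono_left
      (nhdsWithin_mono 0 (fun y (hy : y ∈ Ioi (0 : ℝ)) => (ne_of_gt hy : y ≠ 0)))
    refine h1.congr fun h => ?_
    rw [smul_eq_mul, inv_mul_eq_div]
  have hbv : LocallyBoundedVariationOn (deriv F) D := by
    intro a b ha hb
    rcases lt_or_ge a b with hab | hab
    · obtain ⟨C, hC⟩ := hvar a b ha.1.1 hab hb.1.2
      have h1 : eVariationOn (deriv F) (D ∩ Icc a b) ≤ C := by
        by_contra! h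
        -- Variation is lower semicontinuous under pointwise convergence, and the quotients converge
        -- to `deriv F` on `D`.
        obtain ⟨h0, h2, h3⟩ := ((eVariationOn.lowerSemicontinuous_aux
          (fun x hx => hlim x hx.1) h).and hC).exists
        exact absurd (h2.trans_le ((eVariationOn.mono _ inter_subset_right).trans h3)) (lt_irrefl _)
      exact (h1.trans_lt ENNReal.coe_lt_top).ne
    · have : eVariationOn (deriv F) (D ∩ Icc a b) = 0 :=
        eVariationOn.subsingleton _ fun x hx y hy => by
          have h1 := hx.2; have h2 := hy.2
          simp only [mem_Icc] at h1 h2; linarith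
      simp [BoundedVariationOn, this]
  obtain ⟨p, q, hp, hq, hpq⟩ := hbv.exists_monotoneOn_sub_monotoneOn
  have hbelow : ∀ t ∈ Ioo 0 T, ∃ c ∈ D, c ≤ t := fun t ht => by
    obtain ⟨d, hd, _, h⟩ := hD (t / 2) t (by linarith [ht.1]) (by linarith [ht.1]) ht.2
    exact ⟨d, hd, h.le⟩
  have habove : ∀ t ∈ Ioo 0 T, ∃ c ∈ D, t ≤ c := fun t ht => by
    obtain ⟨d, hd, h, _⟩ := hD t ((t + T) / 2) ht.1 (by linarith [ht.2]) (by linarith [ht.2])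
    exact ⟨d, hd, h.le⟩
  have hright : ∀ t, ∃ l, t ∈ Ioo 0 T → Tendsto (deriv F) (𝓝[D ∩ Ioi t] t) (𝓝 l) := by
    intro t
    by_cases ht : t ∈ Ioo 0 T
    · obtain ⟨l1, h1⟩ := hp.exists_tendsto_right (hbelow t ht)
      obtain ⟨l2, h2⟩ := hq.exists_tendsto_right (hbelow t ht)
      exact ⟨l1 - l2, fun _ => hpq ▸ h1.sub h2⟩
    · exact ⟨0, fun h => absurd h ht⟩
  choose r hr using hright
  have hne : ∀ t ∈ Ioo 0 T, (𝓝[D ∩ Ioi t] t).NeBot := fun t ht =>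
    nhdsWithin_inter_Ioi_neBot hD ht
  refine ⟨r, isCadlagOn_of_tendsto_right hD hr fun t ht => ?_, fun t ht => ?_, ?_⟩
  · obtain ⟨l1, h1⟩ := hp.exists_tendsto_left (habove t ht)
    obtain ⟨l2, h2⟩ := hq.exists_tendsto_left (habove t ht)
    exact ⟨l1 - l2, hpq ▸ h1.sub h2⟩
  · have := hne t ht
    exact ge_of_tendsto (hr t ht) (Eventually.of_forall fun x => hF.deriv_nonneg)
  -- Off the countably many discontinuities of `p` and `q` along `D`, the derivative agrees with its
  -- own right limit.
  · filter_upwards [hae, (hp.countable_not_continuousWithinAt.ae_notMem volume),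
      (hq.countable_not_continuousWithinAt.ae_notMem volume)] with x h1 h2 h3 hx
    have hxD := h1 hx
    have hpc : ContinuousWithinAt p D x := by
      by_contra h; exact h2 ⟨hxD, h⟩
    have hqc : ContinuousWithinAt q D x := by
      by_contra h; exact h3 ⟨hxD, h⟩
    have := hne x hx
    have h4 : Tendsto (deriv F) (𝓝[D ∩ Ioi x] x) (𝓝 (deriv F x)) := by
      have := (hpc.sub hqc).tendsto.mono_left (nhdsWithin_mono x (inter_subset_left (t := Ioi x)))
      rw [hpq]; exact this
    exact tendsto_nhds_unique (hr x hx) h4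

/-- The Lipschitz bound makes the distribution function absolutely continuous on compact
subintervals, so it is the integral of its derivative. The variation bound supplies the càdlàg
version of that derivative. -/
theorem exists_cadlag_density {Ω : Type*} [MeasurableSpace Ω] (μ : Measure Ω)
    [IsProbabilityMeasure μ] {Z : Ω → ℝ} (hZ : Measurable Z) {T : ℝ} (hT : 0 < T)
    (hlip : ∀ a b, 0 < a → a < b → b < T → ∃ K : NNReal,
      LipschitzOnWith K (fun x => μ.real {ω | Z ω ≤ x}) (Icc a b))
    (hvar : ∀ a b, 0 < a → a < b → b < T → ∃ C : NNReal, ∀ᶠ h in 𝓝[>] (0 : ℝ),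
      eVariationOn (fun x => (μ.real {ω | Z ω ≤ x + h} - μ.real {ω | Z ω ≤ x}) / h)
        (Icc a b) ≤ C) :
    ∃ f : ℝ → ℝ, IsCadlagOn f (Ioo 0 T) ∧ (∀ t ∈ Ioo 0 T, 0 ≤ f t) ∧
      ∀ B : Set ℝ, MeasurableSet B → B ⊆ Ioo 0 T →
        μ (Z ⁻¹' B) = ∫⁻ s in B, ENNReal.ofReal (f s) := by
  set F : ℝ → ℝ := fun x => μ.real {ω | Z ω ≤ x} with hFdef
  have hF : Monotone F := fun x y hxy => measureReal_mono fun ω (hω : Z ω ≤ x) => hω.trans hxy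
  obtain ⟨f, hf1, hf2, hf3⟩ := exists_cadlag_ae_eq_deriv hF hvar
  refine ⟨f, hf1, hf2, fun B hB hBT => ?_⟩
  set m := μ.map Z with hm
  set w := (volume : Measure ℝ).withDensity fun x => ENNReal.ofReal (deriv F x) with hw
  have : IsProbabilityMeasure m := Measure.isProbabilityMeasure_map hZ.aemeasurable
  have hIoc : ∀ a b, 0 < a → b < T → m (Ioc a b) = w (Ioc a b) := by
    intro a b ha hb
    rcases le_or_gt b a with hab | hab
    · simp [Ioc_eq_empty (not_lt.2 hab)]
    obtain ⟨K, hK⟩ := hlip a b ha hab hb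
    rw [← uIcc_of_le hab.le] at hK
    have hac := hK.absolutelyContinuousOnInterval
    have hint := hac.intervalIntegrable_deriv
    rw [intervalIntegrable_iff_integrableOn_Ioc_of_le hab.le] at hint
    rw [hw, withDensity_apply _ measurableSet_Ioc,
      ← ofReal_integral_eq_lintegral_ofReal hint (ae_of_all _ fun x => hF.deriv_nonneg),
      ← intervalIntegral.integral_of_le hab.le, hac.integral_deriv_eq_sub,
      hm, Measure.map_apply hZ measurableSet_Ioc]
    have h1 : F b - F a = μ.real (Z ⁻¹' Ioc a b) := by
      have h2 : Z ⁻¹' Ioc a b = {ω | Z ω ≤ b} \ {ω | Z ω ≤ a} := by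
        ext ω; simp [and_comm]
      have h3 : {ω | Z ω ≤ a} ⊆ {ω | Z ω ≤ b} := fun ω hω => le_trans hω hab.le
      rw [h2, measureReal_sdiff h3 (measurableSet_le hZ measurable_const)]
    rw [h1, ofReal_measureReal]
  have hres : ∀ a b, 0 < a → b < T → m.restrict (Ioc a b) = w.restrict (Ioc a b) := by
    intro a b ha hb
    refine Measure.ext_of_Ioc_finite _ _ ?_ fun c d _ => ?_
    · simpa using hIoc a b ha hb
    · rw [Measure.restrict_apply measurableSet_Ioc, Measure.restrict_apply measurableSet_Ioc,
        Ioc_inter_Ioc]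
      exact hIoc _ _ (ha.trans_le le_sup_right) (inf_le_right.trans_lt hb)
  have hU : Ioo 0 T = ⋃ n : ℕ, Ioc (T / (n + 2)) (T - T / (n + 2)) := by
    ext x
    simp only [mem_Ioo, mem_iUnion, mem_Ioc]
    constructor
    · rintro ⟨h0, h1⟩
      obtain ⟨n, hn⟩ := exists_nat_gt (T / min x (T - x))
      have hmin : 0 < min x (T - x) := lt_min h0 (by linarith)
      rw [div_lt_iff₀ hmin] at hn
      have h2 : T / (n + 2) < min x (T - x) := by
        rw [div_lt_iff₀ (by positivity)]; nlinarith
      exact ⟨n, h2.trans_le (min_le_left _ _), by linarith [h2.trans_le (min_le_right _ _)]⟩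
    · rintro ⟨n, h0, h1⟩
      have : 0 < T / (n + 2) := by positivity
      exact ⟨this.trans h0, by linarith⟩
  have hres' : m.restrict (Ioo 0 T) = w.restrict (Ioo 0 T) := by
    rw [hU, Measure.restrict_iUnion_congr]
    intro n
    have : 0 < T / (n + 2) := by positivity
    exact hres _ _ this (by linarith)
  have h1 : m B = w B := by
    have := congrArg (fun k => k B) hres'
    simpa [Measure.restrict_apply hB, inter_eq_left.2 hBT] using this
  rw [← Measure.map_apply hZ hB, ← hm, h1, hw, withDensity_apply _ hB]
  refine setLIntegral_congr_fun_ae hB ?_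
  filter_upwards [hf3] with x hx hxB
  rw [hx (hBT hxB)]

/-! ### Counting windows for a fixed path -/

/-- The deterministic properties of the values `ℓ a b` of an invariant intrinsic location
functional at a fixed path of period `1`. -/
structure IsPeriodicLocation (ℓ : ℝ → ℝ → ℝ) : Prop where
  mem : ∀ a b, a < b → ℓ a b ∈ Icc a b
  stable : ∀ a₁ b₁ a₂ b₂, a₂ < b₂ → a₁ ≤ a₂ → b₂ ≤ b₁ → ℓ a₁ b₁ ∈ Icc a₂ b₂ → ℓ a₂ b₂ = ℓ a₁ b₁
  add_one : ∀ a b, a < b → ℓ (a + 1) (b + 1) = ℓ a b + 1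
  mod_one : ∀ a, ∃ n : ℤ, ℓ a (a + 1) = ℓ 0 1 + n

namespace IsPeriodicLocation

variable {ℓ : ℝ → ℝ → ℝ} (hl : IsPeriodicLocation ℓ)
include hl

/-- If the location moved left while the window moved right, both locations would lie in `[a', b]`,
and stability would identify each with the location of `[a', b]`. -/
theorem mono {a b a' b' : ℝ} (ha : a ≤ a') (hb : b ≤ b') (hab : a < b) (hab' : a' < b') :
    ℓ a b ≤ ℓ a' b' := by
  by_contra! h
  have h1 := hl.mem a b hab
  have h2 := hl.mem a' b' hab'
  have h3 : a' < b := by linarith [h1.2, h2.1]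
  have h4 := hl.stable a b a' b h3 ha le_rfl ⟨by linarith [h2.1], h1.2⟩
  have h5 := hl.stable a' b' a' b h3 le_rfl hb ⟨h2.1, by linarith [h1.2]⟩
  linarith

theorem add_int {a b : ℝ} (hab : a < b) (n : ℤ) : ℓ (a + n) (b + n) = ℓ a b + n := by
  induction n using Int.induction_on with
  | zero => simp
  | succ k ih =>
    have := hl.add_one (a + k) (b + k) (by linarith)
    push_cast at ih ⊢
    rw [← add_assoc, ← add_assoc, this, ih, add_assoc]
  | pred k ih =>
    have := hl.add_one (a + ((-k - 1 : ℤ) : ℝ)) (b + ((-k - 1 : ℤ) : ℝ)) (by linarith)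
    push_cast at ih this ⊢
    rw [show a + (-(k : ℝ) - 1) + 1 = a + -k by ring,
      show b + (-(k : ℝ) - 1) + 1 = b + -k by ring, ih] at this
    linarith

/-- If the windows were closer, both locations would lie in the overlap `[c', c + T]` and so
coincide. The relative positions would then differ by `c' - c ≥ δ`, which is impossible inside a
half-open interval of length `δ`. -/
theorem gap {c c' x δ T : ℝ} (hc : δ ≤ c' - c) (hδ : 0 < δ)
    (h : ℓ c (c + T) - c ∈ Ioc x (x + δ)) (h' : ℓ c' (c' + T) - c' ∈ Ioc x (x + δ)) :
    min x (T - x - δ) < c' - c := by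
  by_contra! hcon
  obtain ⟨h3, h4⟩ := le_min_iff.1 hcon
  obtain ⟨h1, h2⟩ := h
  obtain ⟨h1', h2'⟩ := h'
  have h5 : c' < c + T := by linarith
  have e1 := hl.stable c (c + T) c' (c + T) h5 (by linarith) le_rfl ⟨by linarith, by linarith⟩
  have e2 := hl.stable c' (c' + T) c' (c + T) h5 le_rfl (by linarith) ⟨by linarith, by linarith⟩
  linarith

/-- The location of `[c, c + 1]` is congruent to `ρ` and less than 1 away from it, hence equal to
it; stability passes this to `[c, c + T]`. -/
theorem eq_root {c T ρ : ℝ} (hT : T ≤ 1) (hρ : ∃ n : ℤ, ρ = ℓ 0 1 + n) (h1 : c < ρ)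
    (h2 : ρ < c + T) : ℓ c (c + T) = ρ := by
  obtain ⟨n, hn⟩ := hρ
  obtain ⟨k, hk⟩ := hl.mod_one c
  have hm := hl.mem c (c + 1) (by linarith)
  have h3 : ((k - n : ℤ) : ℝ) = ℓ c (c + 1) - ρ := by push_cast; linarith
  have h4 : k - n < 1 := by
    have : ((k - n : ℤ) : ℝ) < 1 := by rw [h3]; linarith [hm.2]
    exact_mod_cast this
  have h5 : -1 < k - n := by
    have : (-1 : ℝ) < ((k - n : ℤ) : ℝ) := by rw [h3]; linarith [hm.1]
    exact_mod_cast this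
  have h6 : k - n = 0 := by omega
  rw [h6] at h3
  have h7 : ℓ c (c + 1) = ρ := by push_cast at h3; linarith
  rw [← h7]
  exact hl.stable c (c + 1) c (c + T) (by linarith) le_rfl (by linarith)
    ⟨by linarith, by linarith⟩

open scoped Classical in
/-- At most `⌊(1 - T) / d⌋ + 2` of the windows `[kδ, kδ + T]`, which wind once around the circle,
have their location at relative position in `(x, x + δ]`. -/
theorem card_windows_le {x δ T : ℝ} {N : ℕ} (hT : T ≤ 1) (hx : 0 < x) (hδ : 0 < δ)
    (hxT : x + δ < T) (hN : N * δ ≤ 1) :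
    ((Finset.range N).filter fun k : ℕ => ℓ (k * δ) (k * δ + T) - k * δ ∈ Ioc x (x + δ)).card ≤
      ⌊(1 - T) / min x (T - x - δ)⌋₊ + 2 := by
  have hT0 : 0 < T := by linarith
  set d := min x (T - x - δ) with hd
  have hd0 : 0 < d := lt_min hx (by linarith)
  set ρ := ℓ 0 1
  set S := ((Finset.range N).filter fun k : ℕ => ℓ (k * δ) (k * δ + T) - k * δ ∈ Ioc x (x + δ)) with hS
  have hkN : ∀ {k : ℕ}, k ∈ S → ((k : ℝ) + 1) * δ ≤ 1 := by
    intro k hk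
    have h1 : k + 1 ≤ N := Finset.mem_range.1 (Finset.mem_filter.1 hk).1
    have h2 : ((k : ℝ) + 1) ≤ N := by exact_mod_cast h1
    exact (mul_le_mul_of_nonneg_right h2 hδ.le).trans hN
  have hkS : ∀ {k : ℕ}, k ∈ S → ℓ (k * δ) (k * δ + T) - k * δ ∈ Ioc x (x + δ) :=
    fun hk => (Finset.mem_filter.1 hk).2
  rw [← Finset.card_filter_add_card_filter_not (s := S)
    (fun k : ℕ => ∃ n : ℤ, ℓ (k * δ) (k * δ + T) = ρ + n), add_comm]
  refine (add_le_add (b := ⌊(1 - T) / d⌋₊ + 1) (d := 1) ?_ ?_)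
  -- Windows not located on `ρ + ℤ`: the start, measured modulo 1 from `ρ`, lies in `[0, 1 - T]`,
  -- and cells of length `d` contain at most one such start.
  · refine (Finset.card_le_card_of_injOn (t := Finset.range (⌊(1 - T) / d⌋₊ + 1))
      (fun k : ℕ => ⌊Int.fract (k * δ - ρ) / d⌋₊) ?_ ?_).trans (Finset.card_range _).le
    · intro k hk
      obtain ⟨hk, hk2⟩ := Finset.mem_filter.1 hk
      simp only [Finset.coe_range, mem_Iio, Nat.lt_succ_iff]
      refine Nat.floor_le_floor (div_le_div_of_nonneg_right ?_ hd0.le)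
      by_contra! hcon
      -- A start beyond `1 - T` puts the next translate of `ρ` inside the window.
      refine hk2 ⟨⌊k * δ - ρ⌋ + 1, ?_⟩
      push_cast
      rw [Int.fract] at hcon
      have := Int.floor_le (k * δ - ρ)
      have := Int.lt_floor_add_one (k * δ - ρ)
      exact hl.eq_root hT ⟨⌊k * δ - ρ⌋ + 1, by push_cast; rfl⟩ (by linarith) (by linarith)
    · have key : ∀ k ∈ S, ∀ j ∈ S, δ ≤ Int.fract (k * δ - ρ) - Int.fract (j * δ - ρ) →
          ⌊Int.fract (k * δ - ρ) / d⌋₊ ≠ ⌊Int.fract (j * δ - ρ) / d⌋₊ := by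
        intro k hk j hj hkj heq
        -- Translate every window by an integer so that it starts in `[ρ, ρ + 1)`.
        have hwin : ∀ i ∈ S, ℓ (i * δ - ⌊i * δ - ρ⌋) (i * δ - ⌊i * δ - ρ⌋ + T) -
            (i * δ - ⌊i * δ - ρ⌋) ∈ Ioc x (x + δ) := by
          intro i hi
          have := hl.add_int (a := i * δ) (b := i * δ + T) (by linarith) (-⌊i * δ - ρ⌋)
          push_cast at this
          rw [show (i : ℝ) * δ - ⌊i * δ - ρ⌋ + T = i * δ + T + -⌊i * δ - ρ⌋ by ring,
            sub_eq_add_neg ((i : ℝ) * δ), this]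
          convert hkS hi using 1; ring
        have h1 := hl.gap (by simp only [Int.fract] at hkj; linarith) hδ (hwin j hj) (hwin k hk)
        have h2 : d < Int.fract (k * δ - ρ) - Int.fract (j * δ - ρ) := by
          simp only [Int.fract]; linarith
        have h3 := Nat.lt_floor_add_one (Int.fract (k * δ - ρ) / d)
        have h4 := Nat.floor_le (div_nonneg (Int.fract_nonneg (j * δ - ρ)) hd0.le)
        rw [heq, div_lt_iff₀ hd0] at h3
        rw [le_div_iff₀ hd0] at h4
        linarith
      have key2 : ∀ k ∈ S, ∀ j ∈ S, j < k →
          ⌊Int.fract (k * δ - ρ) / d⌋₊ ≠ ⌊Int.fract (j * δ - ρ) / d⌋₊ := by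
        intro k hk j hj hjk
        have h1 : ((j : ℝ) + 1) ≤ k := by exact_mod_cast hjk
        have h2 := mul_le_mul_of_nonneg_right h1 hδ.le
        have h3 := hkN hk
        have h4 : 0 ≤ j * δ := by positivity
        rcases le_or_gt ⌊k * δ - ρ⌋ ⌊j * δ - ρ⌋ with h | h
        · refine key k hk j hj ?_
          have : (⌊k * δ - ρ⌋ : ℝ) ≤ ⌊j * δ - ρ⌋ := by exact_mod_cast h
          simp only [Int.fract]; linarith
        -- The starts wrap around: `(k + 1) * δ ≤ 1` still leaves them at least `δ` apart.
        · refine (key j hj k hk ?_).symm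
          have : (⌊j * δ - ρ⌋ : ℝ) + 1 ≤ ⌊k * δ - ρ⌋ := by exact_mod_cast h
          simp only [Int.fract]; linarith
      intro k hk j hj heq
      have hk := (Finset.mem_filter.1 hk).1
      have hj := (Finset.mem_filter.1 hj).1
      by_contra hne
      rcases lt_or_gt_of_ne hne with h | h
      · exact key2 j hj k hk h heq.symm
      · exact key2 k hk j hj h heq
  -- Two windows located on `ρ + ℤ` would have locations differing by an integer strictly between 0
  -- and 1.
  · have key : ∀ k ∈ S, ∀ j ∈ S, j < k → (∃ n : ℤ, ℓ (k * δ) (k * δ + T) = ρ + n) →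
        ¬ ∃ n : ℤ, ℓ (j * δ) (j * δ + T) = ρ + n := by
      rintro k hk j hj hjk ⟨n, hn⟩ ⟨m, hm⟩
      have h1 : ((j : ℝ) + 1) ≤ k := by exact_mod_cast hjk
      have h2 := mul_le_mul_of_nonneg_right h1 hδ.le
      have h3 := hkN hk
      have h4 : 0 ≤ j * δ := by positivity
      obtain ⟨a1, a2⟩ := hkS hk
      obtain ⟨b1, b2⟩ := hkS hj
      have h5 : (m : ℝ) < n := by linarith
      have h6 : (n : ℝ) < m + 1 := by linarith
      have h5 : m < n := by exact_mod_cast h5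
      have h6 : n < m + 1 := by exact_mod_cast h6
      omega
    rw [Finset.card_le_one]
    intro k hk j hj
    obtain ⟨hk1, hk2⟩ := Finset.mem_filter.1 hk
    obtain ⟨hj1, hj2⟩ := Finset.mem_filter.1 hj
    by_contra hne
    rcases lt_or_gt_of_ne hne with h | h
    · exact key j hj1 k hk1 h hj2 hk2
    · exact key k hk1 j hj1 h hk2 hj2

end IsPeriodicLocation

/-! ### Averaging over shifts of a stationary field -/

/-- The left side is the expected number of events that occur. -/
theorem sum_measureReal_le_of_card_le {Ω ι : Type*} [MeasurableSpace Ω] (μ : Measure Ω)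
    [IsProbabilityMeasure μ] (s : Finset ι) (E : ι → Set Ω) (hE : ∀ i ∈ s, MeasurableSet (E i))
    (K : ℕ) (h : ∀ ω, ∀ S ⊆ s, (∀ i ∈ S, ω ∈ E i) → S.card ≤ K) :
    ∑ i ∈ s, μ.real (E i) ≤ K := by
  classical
  have h1 : ∀ i ∈ s, Integrable ((E i).indicator (1 : Ω → ℝ)) μ := fun i hi =>
    (integrable_const (1 : ℝ)).indicator (hE i hi)
  calc ∑ i ∈ s, μ.real (E i) = ∑ i ∈ s, ∫ ω, (E i).indicator (1 : Ω → ℝ) ω ∂μ :=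
        Finset.sum_congr rfl fun i hi => (integral_indicator_one (hE i hi)).symm
    _ = ∫ ω, ∑ i ∈ s, (E i).indicator (1 : Ω → ℝ) ω ∂μ := (integral_finsetSum _ h1).symm
    _ ≤ ∫ _, (K : ℝ) ∂μ := by
        refine integral_mono (integrable_finsetSum _ h1) (integrable_const _) fun ω => ?_
        simp only [indicator_apply, Pi.one_apply, Finset.sum_boole]
        exact_mod_cast h ω _ (Finset.filter_subset _ _) fun i hi => (Finset.mem_filter.1 hi).2
    _ = K := by simp

/-- The real-valued random field `(a, b) ↦ L(X, [a, b])` of an invariant intrinsic location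
functional at a stationary process. -/
structure IsLocationField {Ω : Type*} [MeasurableSpace Ω] (μ : Measure Ω) (ℓ : Ω → ℝ → ℝ → ℝ) :
    Prop where
  measurable : ∀ a b, a < b → Measurable fun ω => ℓ ω a b
  loc : ∀ ω, IsPeriodicLocation (ℓ ω)
  shift : ∀ (a b a' b' c : ℝ) (B B' : Set ℝ), a < b → a' < b' → MeasurableSet B →
    MeasurableSet B' →
    μ {ω | ℓ ω (a + c) (b + c) - c ∈ B ∧ ℓ ω (a' + c) (b' + c) - c ∈ B'} =
      μ {ω | ℓ ω a b ∈ B ∧ ℓ ω a' b' ∈ B'}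

namespace IsLocationField

variable {Ω : Type*} [MeasurableSpace Ω] {μ : Measure Ω} {ℓ : Ω → ℝ → ℝ → ℝ}
  (hl : IsLocationField μ ℓ)
include hl

theorem shift_single {a b : ℝ} (c : ℝ) {B : Set ℝ} (hab : a < b) (hB : MeasurableSet B) :
    μ {ω | ℓ ω (a + c) (b + c) - c ∈ B} = μ {ω | ℓ ω a b ∈ B} := by
  simpa using hl.shift a b a b c B univ hab hab hB MeasurableSet.univ

variable [IsProbabilityMeasure μ]

theorem mul_measureReal_Ioc_le {x δ T : ℝ} {N : ℕ} (hT : T ≤ 1) (hx : 0 < x) (hδ : 0 < δ)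
    (hxT : x + δ < T) (hN : N * δ ≤ 1) :
    N * μ.real {ω | ℓ ω 0 T ∈ Ioc x (x + δ)} ≤ ⌊(1 - T) / min x (T - x - δ)⌋₊ + 2 := by
  classical
  have hT0 : 0 < T := by linarith
  have h1 := sum_measureReal_le_of_card_le μ (Finset.range N)
    (fun k : ℕ => {ω | ℓ ω (k * δ) (k * δ + T) - k * δ ∈ Ioc x (x + δ)})
    (fun k _ => ((hl.measurable _ _ (by linarith)).sub_const _) measurableSet_Ioc)
    (⌊(1 - T) / min x (T - x - δ)⌋₊ + 2) fun ω S hS hSE =>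
      (Finset.card_le_card fun k hk => Finset.mem_filter.2 ⟨hS hk, hSE k hk⟩).trans
        ((hl.loc ω).card_windows_le hT hx hδ hxT hN)
  have h2 : ∀ k ∈ Finset.range N,
      μ.real {ω | ℓ ω (k * δ) (k * δ + T) - k * δ ∈ Ioc x (x + δ)} =
        μ.real {ω | ℓ ω 0 T ∈ Ioc x (x + δ)} := by
    intro k _
    have := hl.shift_single (k * δ) hT0 (measurableSet_Ioc (a := x) (b := x + δ))
    rw [zero_add, add_comm T] at this
    simp only [Measure.real, this]
  rw [Finset.sum_congr rfl h2, Finset.sum_const, Finset.card_range, nsmul_eq_mul] at h1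
  exact_mod_cast h1

/-- The shifts of this jump event by `k * h`, `k < M`, are disjoint. If those for `k < j` both
occurred, cutting the windows at the common right end `T` would put the location for left end `(k +
1) * h` to the right of the one for left end `j * h`, against `mono`. -/
theorem mul_measureReal_left_le {h t₁ t₂ T : ℝ} {M : ℕ} (hh : 0 < h) (h1 : M * h ≤ t₁)
    (h2 : t₂ + M * h ≤ T) (hhT : h < T) :
    M * μ.real {ω | ℓ ω h T ∈ Ioc t₁ t₂ ∧ ℓ ω 0 T ∈ Iio h} ≤ 1 := by
  have hT0 : 0 < T := hh.trans hhT
  have key := sum_measureReal_le_of_card_le μ (Finset.range M)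
    (fun k : ℕ => {ω | ℓ ω (h + k * h) (T + k * h) - k * h ∈ Ioc t₁ t₂ ∧
      ℓ ω (0 + k * h) (T + k * h) - k * h ∈ Iio h})
    (fun k _ => (((hl.measurable _ _ (by linarith)).sub_const _) measurableSet_Ioc).inter
      (((hl.measurable _ _ (by linarith)).sub_const _) measurableSet_Iio)) 1 fun ω S hS hSE => by
      have hL := hl.loc ω
      have aux : ∀ k < M, ∀ j < M, k < j →
          ¬ ((ℓ ω (h + k * h) (T + k * h) - k * h ∈ Ioc t₁ t₂ ∧
            ℓ ω (0 + k * h) (T + k * h) - k * h ∈ Iio h) ∧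
            (ℓ ω (h + j * h) (T + j * h) - j * h ∈ Ioc t₁ t₂ ∧
            ℓ ω (0 + j * h) (T + j * h) - j * h ∈ Iio h)) := by
        rintro k hk j hj hkj ⟨⟨⟨a1, a2⟩, -⟩, ⟨-, a3⟩⟩
        rw [mem_Iio] at a3
        have b1 : ((k : ℝ) + 1) * h ≤ M * h :=
          mul_le_mul_of_nonneg_right (by exact_mod_cast hk) hh.le
        have b2 : ((j : ℝ) + 1) * h ≤ M * h :=
          mul_le_mul_of_nonneg_right (by exact_mod_cast hj) hh.le
        have b3 : ((k : ℝ) + 1) * h ≤ j * h :=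
          mul_le_mul_of_nonneg_right (by exact_mod_cast hkj) hh.le
        have b4 : 0 ≤ (k : ℝ) * h := by positivity
        have m1 := hL.mem (h + k * h) (T + k * h) (by linarith)
        have m2 := hL.mem (0 + j * h) (T + j * h) (by linarith)
        have e1 := hL.stable (h + k * h) (T + k * h) (h + k * h) T (by linarith) le_rfl
          (by linarith) ⟨m1.1, by linarith⟩
        have e2 := hL.stable (0 + j * h) (T + j * h) (0 + j * h) T (by linarith) le_rfl
          (by linarith) ⟨m2.1, by linarith⟩
        have := hL.mono (a := h + k * h) (b := T) (a' := 0 + j * h) (b' := T)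
          (by linarith) le_rfl (by linarith) (by linarith)
        linarith
      rw [Finset.card_le_one]
      intro k hk j hj
      have hkM := Finset.mem_range.1 (hS hk)
      have hjM := Finset.mem_range.1 (hS hj)
      by_contra hne
      rcases lt_or_gt_of_ne hne with hlt | hlt
      · exact aux k hkM j hjM hlt ⟨hSE k hk, hSE j hj⟩
      · exact aux j hjM k hkM hlt ⟨hSE j hj, hSE k hk⟩
  have e : ∀ k ∈ Finset.range M, μ.real {ω | ℓ ω (h + k * h) (T + k * h) - k * h ∈ Ioc t₁ t₂ ∧
      ℓ ω (0 + k * h) (T + k * h) - k * h ∈ Iio h} =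
      μ.real {ω | ℓ ω h T ∈ Ioc t₁ t₂ ∧ ℓ ω 0 T ∈ Iio h} := fun k _ => by
    simp only [Measure.real]
    rw [hl.shift h T 0 T (k * h) _ _ hhT hT0 measurableSet_Ioc measurableSet_Iio]
  rw [Finset.sum_congr rfl e, Finset.sum_const, Finset.card_range, nsmul_eq_mul] at key
  exact_mod_cast key

/-- Mirror image of `mul_measureReal_left_le`: shift to the left and cut at the common left end `h`.
-/
theorem mul_measureReal_right_le {h t₁ t₂ T : ℝ} {M : ℕ} (hh : 0 < h) (h1 : M * h ≤ t₁)
    (h2 : t₂ + M * h ≤ T) (hhT : h < T) :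
    M * μ.real {ω | ℓ ω h T ∈ Ioc t₁ t₂ ∧ ℓ ω h (T + h) ∈ Ioi T} ≤ 1 := by
  have hT0 : 0 < T := hh.trans hhT
  have key := sum_measureReal_le_of_card_le μ (Finset.range M)
    (fun k : ℕ => {ω | ℓ ω (h + -(k * h)) (T + -(k * h)) - -(k * h) ∈ Ioc t₁ t₂ ∧
      ℓ ω (h + -(k * h)) (T + h + -(k * h)) - -(k * h) ∈ Ioi T})
    (fun k _ => (((hl.measurable _ _ (by linarith)).sub_const _) measurableSet_Ioc).inter
      (((hl.measurable _ _ (by linarith)).sub_const _) measurableSet_Ioi)) 1 fun ω S hS hSE => by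
      have hL := hl.loc ω
      have aux : ∀ k < M, ∀ j < M, j < k →
          ¬ ((ℓ ω (h + -(k * h)) (T + -(k * h)) - -(k * h) ∈ Ioc t₁ t₂ ∧
            ℓ ω (h + -(k * h)) (T + h + -(k * h)) - -(k * h) ∈ Ioi T) ∧
            (ℓ ω (h + -(j * h)) (T + -(j * h)) - -(j * h) ∈ Ioc t₁ t₂ ∧
            ℓ ω (h + -(j * h)) (T + h + -(j * h)) - -(j * h) ∈ Ioi T)) := by
        rintro k hk j hj hkj ⟨⟨-, a3⟩, ⟨⟨a1, a2⟩, -⟩⟩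
        rw [mem_Ioi] at a3
        have b1 : ((k : ℝ) + 1) * h ≤ M * h :=
          mul_le_mul_of_nonneg_right (by exact_mod_cast hk) hh.le
        have b2 : ((j : ℝ) + 1) * h ≤ M * h :=
          mul_le_mul_of_nonneg_right (by exact_mod_cast hj) hh.le
        have b3 : ((j : ℝ) + 1) * h ≤ k * h :=
          mul_le_mul_of_nonneg_right (by exact_mod_cast hkj) hh.le
        have b4 : 0 ≤ (j : ℝ) * h := by positivity
        have m1 := hL.mem (h + -(k * h)) (T + h + -(k * h)) (by linarith)
        have m2 := hL.mem (h + -(j * h)) (T + -(j * h)) (by linarith)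
        have e1 := hL.stable (h + -(k * h)) (T + h + -(k * h)) h (T + h + -(k * h)) (by linarith)
          (by linarith) le_rfl ⟨by linarith, m1.2⟩
        have e2 := hL.stable (h + -(j * h)) (T + -(j * h)) h (T + -(j * h)) (by linarith)
          (by linarith) le_rfl ⟨by linarith, m2.2⟩
        have := hL.mono (a := h) (b := T + h + -(k * h)) (a' := h) (b' := T + -(j * h))
          le_rfl (by linarith) (by linarith) (by linarith)
        linarith
      rw [Finset.card_le_one]
      intro k hk j hj
      have hkM := Finset.mem_range.1 (hS hk)
      have hjM := Finset.mem_range.1 (hS hj)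
      by_contra hne
      rcases lt_or_gt_of_ne hne with hlt | hlt
      · exact aux j hjM k hkM hlt ⟨hSE j hj, hSE k hk⟩
      · exact aux k hkM j hjM hlt ⟨hSE k hk, hSE j hj⟩
  have e : ∀ k ∈ Finset.range M,
      μ.real {ω | ℓ ω (h + -(k * h)) (T + -(k * h)) - -(k * h) ∈ Ioc t₁ t₂ ∧
        ℓ ω (h + -(k * h)) (T + h + -(k * h)) - -(k * h) ∈ Ioi T} =
      μ.real {ω | ℓ ω h T ∈ Ioc t₁ t₂ ∧ ℓ ω h (T + h) ∈ Ioi T} := fun k _ => by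
    simp only [Measure.real]
    rw [hl.shift h T h (T + h) (-(k * h)) _ _ hhT (by linarith) measurableSet_Ioc
      measurableSet_Ioi]
  rw [Finset.sum_congr rfl e, Finset.sum_const, Finset.card_range, nsmul_eq_mul] at key
  exact_mod_cast key

end IsLocationField

/-! ### Regularity of the distribution function -/

/-- Turns a count bound `⌊r⁻¹⌋₊ * p ≤ K` into `p ≤ 2 * r * K`; the lost factor 2 is harmless where
only finiteness matters. -/
theorem Nat.one_le_two_mul_mul_floor_inv {r : ℝ} (h0 : 0 < r) (h1 : r ≤ 1) :
    1 ≤ 2 * r * ⌊r⁻¹⌋₊ := by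
  have h2 : 1 ≤ ⌊r⁻¹⌋₊ := Nat.le_floor (by simpa using (one_le_inv₀ h0).2 h1)
  have h3 : (1 : ℝ) ≤ ⌊r⁻¹⌋₊ := by exact_mod_cast h2
  have h4 := Nat.lt_floor_add_one r⁻¹
  have h5 : r * r⁻¹ = 1 := mul_inv_cancel₀ h0.ne'
  nlinarith

theorem measureReal_Ioc_eq_sub {Ω : Type*} [MeasurableSpace Ω] {μ : Measure Ω}
    [IsFiniteMeasure μ] {Z : Ω → ℝ} (hZ : Measurable Z) {x y : ℝ} (hxy : x ≤ y) :
    μ.real {ω | Z ω ∈ Ioc x y} = μ.real {ω | Z ω ≤ y} - μ.real {ω | Z ω ≤ x} := by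
  have h2 : {ω | Z ω ∈ Ioc x y} = {ω | Z ω ≤ y} \ {ω | Z ω ≤ x} := by
    ext ω; simp [and_comm]
  have h3 : {ω | Z ω ≤ x} ⊆ {ω | Z ω ≤ y} := fun ω hω => le_trans hω hxy
  rw [h2, measureReal_sdiff h3 (measurableSet_le hZ measurable_const)]

theorem eVariationOn_le_of_dist_le_sub {f g : ℝ → ℝ} {s : Set ℝ}
    (h : ∀ x ∈ s, ∀ y ∈ s, x ≤ y → |f y - f x| ≤ g y - g x) :
    eVariationOn f s ≤ eVariationOn g s := by
  refine iSup_le fun p => (Finset.sum_le_sum fun i _ => ?_).trans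
    (le_iSup (fun p : ℕ × { u : ℕ → ℝ // Monotone u ∧ ∀ i, u i ∈ s } =>
      ∑ i ∈ Finset.range p.1, edist (g ((p.2 : ℕ → ℝ) (i + 1))) (g ((p.2 : ℕ → ℝ) i))) p)
  have hxy : (p.2 : ℕ → ℝ) i ≤ (p.2 : ℕ → ℝ) (i + 1) := p.2.2.1 (Nat.le_succ i)
  rw [edist_dist, edist_dist, Real.dist_eq, Real.dist_eq]
  exact ENNReal.ofReal_le_ofReal
    ((h _ (p.2.2.2 i) _ (p.2.2.2 (i + 1)) hxy).trans (le_abs_self _))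

namespace IsLocationField

variable {Ω : Type*} [MeasurableSpace Ω] {μ : Measure Ω} {ℓ : Ω → ℝ → ℝ → ℝ}
  (hl : IsLocationField μ ℓ) [IsProbabilityMeasure μ]
include hl

theorem lipschitzOnWith_cdf {a b T : ℝ} (hT : T ≤ 1) (ha : 0 < a) (hb : b < T) :
    ∃ K : NNReal, LipschitzOnWith K (fun x => μ.real {ω | ℓ ω 0 T ≤ x}) (Icc a b) := by
  rcases lt_or_ge b a with hab | hab
  · exact ⟨0, by simp [Icc_eq_empty (not_le.2 hab)]⟩
  have hT0 : 0 < T := by linarith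
  set K₀ := ⌊(1 - T) / min a (T - b)⌋₊ + 2 with hK₀
  refine ⟨2 * K₀, LipschitzOnWith.of_le_add_mul _ fun y hy x hx => ?_⟩
  rcases le_or_gt y x with hxy | hxy
  · have h1 : μ.real {ω | ℓ ω 0 T ≤ y} ≤ μ.real {ω | ℓ ω 0 T ≤ x} :=
      measureReal_mono fun ω (hω : ℓ ω 0 T ≤ y) => hω.trans hxy
    have h2 : 0 ≤ ((2 * K₀ : NNReal) : ℝ) * dist y x := by positivity
    linarith
  have h1 := measureReal_Ioc_eq_sub (μ := μ) (hl.measurable 0 T hT0) hxy.le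
  have hd0 : 0 < min a (T - b) := lt_min ha (by linarith)
  set δ := y - x with hδ
  have hδ0 : 0 < δ := by linarith
  have hδ1 : δ ≤ 1 := by linarith [hx.1, hy.2]
  have h2 := Nat.one_le_two_mul_mul_floor_inv hδ0 hδ1
  have h3 := hl.mul_measureReal_Ioc_le (x := x) (δ := δ) (N := ⌊δ⁻¹⌋₊) hT
    (ha.trans_le hx.1) hδ0 (by linarith [hy.2])
    (by rw [← le_div_iff₀ hδ0, one_div]; exact Nat.floor_le (inv_nonneg.2 hδ0.le))
  have h4 : ⌊(1 - T) / min x (T - x - δ)⌋₊ + 2 ≤ K₀ := by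
    exact Nat.add_le_add_right (Nat.floor_le_floor (div_le_div_of_nonneg_left (by linarith) hd0
      (min_le_min hx.1 (by linarith [hy.2])))) 2
  have h4 : (⌊(1 - T) / min x (T - x - δ)⌋₊ + 2 : ℝ) ≤ K₀ := by exact_mod_cast h4
  rw [show x + δ = y by ring] at h3
  have h5 : μ.real {ω | ℓ ω 0 T ∈ Ioc x y} ≤ 2 * K₀ * δ := by
    have h6 : 0 ≤ μ.real {ω | ℓ ω 0 T ∈ Ioc x y} := measureReal_nonneg
    calc _ ≤ (2 * δ * ⌊δ⁻¹⌋₊) * μ.real {ω | ℓ ω 0 T ∈ Ioc x y} := le_mul_of_one_le_left h6 h2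
      _ = 2 * δ * (⌊δ⁻¹⌋₊ * μ.real {ω | ℓ ω 0 T ∈ Ioc x y}) := by ring
      _ ≤ 2 * δ * K₀ := by gcongr; exact h3.trans h4
      _ = 2 * K₀ * δ := by ring
  rw [Real.dist_eq, abs_of_pos (by linarith)]
  push_cast
  linarith

/-- The increments over steps of length `h` of the distribution function differ by the
probabilities that the location jumps when an end of the window is moved by `h`. -/
theorem abs_increment_sub_le {h a x y T : ℝ} (hh : 0 < h) (ha : 0 ≤ a) (hax : a ≤ x) (hxy : x ≤ y)
    (hyT : y + h ≤ T) (hhT : h < T) :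
    |(μ.real {ω | ℓ ω 0 T ≤ y + h} - μ.real {ω | ℓ ω 0 T ≤ y}) -
      (μ.real {ω | ℓ ω 0 T ≤ x + h} - μ.real {ω | ℓ ω 0 T ≤ x})| ≤
    (μ.real {ω | ℓ ω h T ∈ Ioc a (y + h) ∧ ℓ ω 0 T ∈ Iio h} +
      μ.real {ω | ℓ ω h T ∈ Ioc a (y + h) ∧ ℓ ω h (T + h) ∈ Ioi T}) -
    (μ.real {ω | ℓ ω h T ∈ Ioc a (x + h) ∧ ℓ ω 0 T ∈ Iio h} +
      μ.real {ω | ℓ ω h T ∈ Ioc a (x + h) ∧ ℓ ω h (T + h) ∈ Ioi T}) := by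
  have hT0 : 0 < T := hh.trans hhT
  have mh := hl.measurable h T hhT
  have m0 := hl.measurable 0 T hT0
  have mT := hl.measurable h (T + h) (by linarith)
  have e1 := measureReal_Ioc_eq_sub (μ := μ) m0 hxy
  have e2 := measureReal_Ioc_eq_sub (μ := μ) m0 (add_le_add_left hxy h)
  -- Stationarity turns the comparison of two intervals into one of the windows `[0, T]` and `[h, T
  -- + h]` on the same interval. Both are then compared with their intersection `[h, T]`.
  have e3 : μ.real {ω | ℓ ω 0 T ∈ Ioc x y} =
      μ.real {ω | ℓ ω h (T + h) ∈ Ioc (x + h) (y + h)} := by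
    have := hl.shift_single h hT0 (measurableSet_Ioc (a := x) (b := y))
    simp only [Measure.real, ← this]
    congr 3; ext ω
    simp [lt_sub_iff_add_lt]
  have split : ∀ (E : Set Ω), MeasurableSet E →
      μ.real {ω | ℓ ω h T ∈ Ioc a (y + h) ∧ ω ∈ E} -
        μ.real {ω | ℓ ω h T ∈ Ioc a (x + h) ∧ ω ∈ E} =
      μ.real {ω | ℓ ω h T ∈ Ioc (x + h) (y + h) ∧ ω ∈ E} := by
    intro E hE
    have hsub : {ω | ℓ ω h T ∈ Ioc a (x + h) ∧ ω ∈ E} ⊆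
        {ω | ℓ ω h T ∈ Ioc a (y + h) ∧ ω ∈ E} :=
      fun ω hω => ⟨⟨hω.1.1, hω.1.2.trans (by linarith)⟩, hω.2⟩
    rw [← measureReal_sdiff hsub ((mh measurableSet_Ioc).inter hE)]
    congr 1; ext ω
    simp only [Set.mem_sdiff, Set.mem_ofPred_eq, mem_Ioc]
    constructor
    · rintro ⟨⟨⟨h1, h2⟩, h3⟩, h4⟩
      exact ⟨⟨not_le.1 fun h5 => h4 ⟨⟨h1, h5⟩, h3⟩, h2⟩, h3⟩
    · rintro ⟨⟨h1, h2⟩, h3⟩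
      exact ⟨⟨⟨by linarith, h2⟩, h3⟩, fun h4 => absurd h4.1.2 (not_le.2 h1)⟩
  have s1 := split {ω | ℓ ω 0 T ∈ Iio h} (m0 measurableSet_Iio)
  have s2 := split {ω | ℓ ω h (T + h) ∈ Ioi T} (mT measurableSet_Ioi)
  have d1 : μ.real {ω | ℓ ω 0 T ∈ Ioc (x + h) (y + h)} =
      μ.real {ω | ℓ ω h T ∈ Ioc (x + h) (y + h)} -
      μ.real {ω | ℓ ω h T ∈ Ioc (x + h) (y + h) ∧ ω ∈ {ω | ℓ ω 0 T ∈ Iio h}} := by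
    have hsub : {ω | ℓ ω h T ∈ Ioc (x + h) (y + h) ∧ ω ∈ {ω | ℓ ω 0 T ∈ Iio h}} ⊆
      {ω | ℓ ω h T ∈ Ioc (x + h) (y + h)} := fun ω hω => hω.1
    rw [← measureReal_sdiff hsub ((mh measurableSet_Ioc).inter (m0 measurableSet_Iio))]
    congr 1; ext ω
    have m := (hl.loc ω).mem 0 T hT0
    have st := (hl.loc ω).stable 0 T h T hhT hh.le le_rfl
    simp only [Set.mem_sdiff, Set.mem_ofPred_eq]
    constructor
    · intro h1
      have := st ⟨by linarith [h1.1], m.2⟩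
      rw [this]
      exact ⟨h1, fun h2 => not_lt.2 (by linarith [h1.1] : h ≤ ℓ ω 0 T) h2.2⟩
    · rintro ⟨h1, h2⟩
      have h3 : h ≤ ℓ ω 0 T := not_lt.1 fun h3 => h2 ⟨h1, h3⟩
      rwa [← st ⟨h3, m.2⟩]
  have d2 : μ.real {ω | ℓ ω h (T + h) ∈ Ioc (x + h) (y + h)} =
      μ.real {ω | ℓ ω h T ∈ Ioc (x + h) (y + h)} -
      μ.real {ω | ℓ ω h T ∈ Ioc (x + h) (y + h) ∧ ω ∈ {ω | ℓ ω h (T + h) ∈ Ioi T}} := by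
    have hsub : {ω | ℓ ω h T ∈ Ioc (x + h) (y + h) ∧ ω ∈ {ω | ℓ ω h (T + h) ∈ Ioi T}} ⊆
      {ω | ℓ ω h T ∈ Ioc (x + h) (y + h)} := fun ω hω => hω.1
    rw [← measureReal_sdiff hsub ((mh measurableSet_Ioc).inter (mT measurableSet_Ioi))]
    congr 1; ext ω
    have m := (hl.loc ω).mem h (T + h) (by linarith)
    have st := (hl.loc ω).stable h (T + h) h T hhT le_rfl (by linarith)
    simp only [Set.mem_sdiff, Set.mem_ofPred_eq]
    constructor
    · intro h1
      have := st ⟨m.1, by linarith [h1.2]⟩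
      rw [this]
      exact ⟨h1, fun h2 => not_lt.2 (by linarith [h1.2] : ℓ ω h (T + h) ≤ T) h2.2⟩
    · rintro ⟨h1, h2⟩
      have h3 : ℓ ω h (T + h) ≤ T := not_lt.1 fun h3 => h2 ⟨h1, h3⟩
      rwa [← st ⟨m.1, h3⟩]
  have p1 : 0 ≤ μ.real {ω | ℓ ω h T ∈ Ioc (x + h) (y + h) ∧ ω ∈ {ω | ℓ ω 0 T ∈ Iio h}} :=
    measureReal_nonneg
  have p2 : 0 ≤ μ.real {ω | ℓ ω h T ∈ Ioc (x + h) (y + h) ∧ ω ∈ {ω | ℓ ω h (T + h) ∈ Ioi T}} :=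
    measureReal_nonneg
  simp only [Set.mem_ofPred_eq] at s1 s2 d1 d2 p1 p2
  rw [abs_le]
  constructor <;> linarith

theorem eVariationOn_difference_quotient_le {a b T : ℝ} (ha : 0 < a) (hab : a < b) (hb : b < T) :
    ∃ C : NNReal, ∀ᶠ h in 𝓝[>] (0 : ℝ),
      eVariationOn (fun x => (μ.real {ω | ℓ ω 0 T ≤ x + h} - μ.real {ω | ℓ ω 0 T ≤ x}) / h)
        (Icc a b) ≤ C := by
  -- Room for shifts of total length `M * h ≤ ε`: the event reaches up to `b + h`, so `b + h + ε ≤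
  -- T` is needed, hence the half.
  set ε := min a ((T - b) / 2) with hε
  have hε0 : 0 < ε := lt_min ha (by linarith)
  have hεa : ε ≤ a := min_le_left _ _
  have hεb : ε ≤ (T - b) / 2 := min_le_right _ _
  refine ⟨(4 / ε).toNNReal, ?_⟩
  filter_upwards [Ioo_mem_nhdsGT hε0] with h ⟨hh, hhε⟩
  have hhT : h < T := by linarith
  set G : ℝ → ℝ := fun x => (μ.real {ω | ℓ ω h T ∈ Ioc a (x + h) ∧ ℓ ω 0 T ∈ Iio h} +
      μ.real {ω | ℓ ω h T ∈ Ioc a (x + h) ∧ ℓ ω h (T + h) ∈ Ioi T}) / h with hG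
  have hle : ∀ x ∈ Icc a b, ∀ y ∈ Icc a b, x ≤ y →
      |(μ.real {ω | ℓ ω 0 T ≤ y + h} - μ.real {ω | ℓ ω 0 T ≤ y}) / h -
        (μ.real {ω | ℓ ω 0 T ≤ x + h} - μ.real {ω | ℓ ω 0 T ≤ x}) / h| ≤ G y - G x := by
    intro x hx y hy hxy
    rw [← sub_div, abs_div, abs_of_pos hh, hG, ← sub_div]
    refine div_le_div_of_nonneg_right ?_ hh.le
    exact hl.abs_increment_sub_le hh ha.le hx.1 hxy (by linarith [hy.2]) hhT
  have hmono : MonotoneOn G (Icc a b) := fun x hx y hy hxy =>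
    sub_nonneg.1 ((abs_nonneg _).trans (hle x hx y hy hxy))
  refine (eVariationOn_le_of_dist_le_sub hle).trans ?_
  have h1 := (hmono.eVariationOn_eq (left_mem_Icc.2 hab.le) (right_mem_Icc.2 hab.le)).le
  rw [inter_self] at h1
  refine h1.trans ?_
  rw [ENNReal.ofReal]
  refine ENNReal.coe_le_coe.2 (Real.toNNReal_le_toNNReal ?_)
  have hGa : 0 ≤ G a := by positivity
  suffices G b ≤ 4 / ε by linarith
  set M := ⌊(h / ε)⁻¹⌋₊ with hM
  have hM1 := Nat.one_le_two_mul_mul_floor_inv (div_pos hh hε0) ((div_le_one hε0).2 hhε.le)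
  have hM2 : M * h ≤ ε := by
    rw [← le_div_iff₀ hh, ← inv_div]
    exact Nat.floor_le (by positivity)
  have q1 := hl.mul_measureReal_left_le (t₁ := a) (t₂ := b + h) (M := M) hh (by linarith)
    (by linarith) hhT
  have q2 := hl.mul_measureReal_right_le (t₁ := a) (t₂ := b + h) (M := M) hh (by linarith)
    (by linarith) hhT
  have bound : ∀ p : ℝ, 0 ≤ p → M * p ≤ 1 → p ≤ 2 * (h / ε) := fun p hp hp1 => by
    calc p ≤ (2 * (h / ε) * M) * p := le_mul_of_one_le_left hp hM1
      _ = 2 * (h / ε) * (M * p) := by ring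
      _ ≤ 2 * (h / ε) * 1 := by gcongr
      _ = 2 * (h / ε) := mul_one _
  have b1 := bound _ measureReal_nonneg q1
  have b2 := bound _ measureReal_nonneg q2
  rw [hG]
  simp only
  rw [div_le_iff₀ hh]
  calc _ ≤ 2 * (h / ε) + 2 * (h / ε) := add_le_add b1 b2
    _ = 4 / ε * h := by ring

end IsLocationField

/-! ### The upper bound -/

theorem le_of_setLIntegral_Ioc_le {f : ℝ → ℝ} {t K : ℝ} (hf : ContinuousWithinAt f (Ici t) t)
    (hK : 0 ≤ K) (h : ∃ᶠ δ in 𝓝[>] (0 : ℝ),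
      ∫⁻ s in Ioc t (t + δ), ENNReal.ofReal (f s) ≤ ENNReal.ofReal (K * δ)) : f t ≤ K := by
  by_contra! hlt
  obtain ⟨c, hKc, hc⟩ := exists_between hlt
  have h1 : ∀ᶠ s in 𝓝[≥] t, c < f s := hf.eventually (lt_mem_nhds hc)
  obtain ⟨u, hu, h2⟩ := (mem_nhdsGE_iff_exists_Ico_subset).1 h1
  obtain ⟨δ, h3, hδ0, hδu⟩ := (h.and_eventually
    (Ioo_mem_nhdsGT (show (0 : ℝ) < u - t from sub_pos.2 hu))).exists
  have h4 : ∫⁻ _ in Ioc t (t + δ), ENNReal.ofReal c ≤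
      ∫⁻ s in Ioc t (t + δ), ENNReal.ofReal (f s) :=
    setLIntegral_mono' measurableSet_Ioc fun s hs => ENNReal.ofReal_le_ofReal
      (le_of_lt (h2 ⟨hs.1.le, by linarith [hs.2]⟩))
  rw [setLIntegral_const, Real.volume_Ioc, add_sub_cancel_left,
    ← ENNReal.ofReal_mul (by linarith)] at h4
  have h5 := (ENNReal.ofReal_le_ofReal_iff (by positivity)).1 (h4.trans h3)
  nlinarith

theorem le_of_le_setLIntegral_Ioc {f : ℝ → ℝ} {t K : ℝ} (hf : ContinuousWithinAt f (Ici t) t)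
    (hft : 0 ≤ f t) (h : ∃ᶠ δ in 𝓝[>] (0 : ℝ),
      ENNReal.ofReal (K * δ) ≤ ∫⁻ s in Ioc t (t + δ), ENNReal.ofReal (f s)) : K ≤ f t := by
  by_contra! hlt
  obtain ⟨c, hc, hKc⟩ := exists_between hlt
  have h1 : ∀ᶠ s in 𝓝[≥] t, f s < c := hf.eventually (gt_mem_nhds hc)
  obtain ⟨u, hu, h2⟩ := (mem_nhdsGE_iff_exists_Ico_subset).1 h1
  obtain ⟨δ, h3, hδ0, hδu⟩ := (h.and_eventually
    (Ioo_mem_nhdsGT (show (0 : ℝ) < u - t from sub_pos.2 hu))).exists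
  have h4 : ∫⁻ s in Ioc t (t + δ), ENNReal.ofReal (f s) ≤
      ∫⁻ _ in Ioc t (t + δ), ENNReal.ofReal c :=
    setLIntegral_mono' measurableSet_Ioc fun s hs => ENNReal.ofReal_le_ofReal
      (le_of_lt (h2 ⟨hs.1.le, by linarith [hs.2]⟩))
  rw [setLIntegral_const, Real.volume_Ioc, add_sub_cancel_left,
    ← ENNReal.ofReal_mul (by linarith)] at h4
  have h5 := (ENNReal.ofReal_le_ofReal_iff (by nlinarith)).1 (h3.trans h4)
  nlinarith

section

variable {H : PathClass} {L : H.Path → ℝ → ℝ → WithTop ℝ} (hL : IsInvariantLocation H L)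
include hL

theorem IsInvariantLocation.coe_untopD (g : H.Path) {a b : ℝ} (hab : a < b) :
    (((L g a b).untopD 0 : ℝ) : WithTop ℝ) = L g a b := by
  obtain ⟨x, hx⟩ := WithTop.ne_top_iff_exists.1 (hL.ne_top g a b hab)
  rw [← hx, WithTop.untopD_coe]

theorem IsInvariantLocation.untopD_shift (g : H.Path) {a b : ℝ} (c : ℝ) (hab : a < b) :
    (L g (a + c) (b + c)).untopD 0 - c = (L (H.shift c g) a b).untopD 0 := by
  have h1 := hL.shift_compat g (a + c) (b + c) c (by linarith)
  rw [add_sub_cancel_right, add_sub_cancel_right, ← hL.coe_untopD _ hab,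
    ← hL.coe_untopD g (by linarith), ← WithTop.coe_add, WithTop.coe_inj] at h1
  linarith

theorem IsInvariantLocation.isPeriodicLocation (g : H.Path) :
    IsPeriodicLocation fun a b => (L g a b).untopD 0 where
  mem a b hab := by
    rcases hL.mem_or_top g a b hab with h | ⟨x, hx, h⟩
    · exact absurd h (hL.ne_top g a b hab)
    · rwa [h, WithTop.untopD_coe]
  stable a₁ b₁ a₂ b₂ h h1 h2 h3 := by
    rw [hL.stable g a₁ b₁ a₂ b₂ h h1 h2 ⟨_, h3, (hL.coe_untopD g (by linarith)).symm⟩]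
  add_one a b hab := by
    have h1 := hL.untopD_shift g 1 hab
    -- Periodicity of the path enters here.
    have h2 : H.shift 1 g = g := Subtype.ext (funext (H.periodic g.1 g.2))
    rw [h2] at h1
    linarith
  mod_one a := by
    obtain ⟨n, hn⟩ := hL.mod_one g a
    refine ⟨n, ?_⟩
    rw [← hL.coe_untopD g (by linarith), ← hL.coe_untopD g zero_lt_one, ← WithTop.coe_add,
      WithTop.coe_inj] at hn
    exact hn

theorem IsInvariantLocation.isLocationField {Ω : Type*} [MeasurableSpace Ω] {μ : Measure Ω}
    {X : Ω → H.Path} (hX : IsStationaryProcess μ H X) :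
    IsLocationField μ fun ω a b => (L (X ω) a b).untopD 0 where
  measurable a b hab := ((hL.measurable a b hab).comp hX.measurable).untopD 0
  loc ω := hL.isPeriodicLocation (X ω)
  shift a b a' b' c B B' hab hab' hB hB' := by
    simp only [hL.untopD_shift _ c hab, hL.untopD_shift _ c hab']
    have hA : MeasurableSet {g : H.Path | (L g a b).untopD 0 ∈ B ∧ (L g a' b').untopD 0 ∈ B'} :=
      (((hL.measurable a b hab).untopD 0) hB).inter (((hL.measurable a' b' hab').untopD 0) hB')
    obtain ⟨A, hA, hAeq⟩ := hA
    have h0 : Measurable fun ω => (X ω).1 := measurable_subtype_coe.comp hX.measurable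
    have hc : Measurable fun ω => fun t : ℝ => (X ω).1 (t + c) :=
      measurable_pi_lambda _ fun t => (measurable_pi_apply (t + c)).comp h0
    have h1 := congrArg (fun ν => ν A) (hX.stationary c)
    simp only [Measure.map_apply hc hA, Measure.map_apply h0 hA] at h1
    have h2 : ∀ g : H.Path, g.1 ∈ A ↔ (L g a b).untopD 0 ∈ B ∧ (L g a' b').untopD 0 ∈ B' :=
      fun g => Set.ext_iff.1 hAeq g
    simp only [← h2]
    exact h1

theorem IsInvariantLocation.locationLaw_image {Ω : Type*} [MeasurableSpace Ω] {μ : Measure Ω}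
    {X : Ω → H.Path} (hX : IsStationaryProcess μ H X) {T : ℝ} (hT : 0 < T) {B : Set ℝ}
    (hB : MeasurableSet B) :
    locationLaw μ L X T ((fun x : ℝ => (x : WithTop ℝ)) '' B) =
      μ {ω | (L (X ω) 0 T).untopD 0 ∈ B} := by
  -- The point `⊤` is removed because `untopD 0` sends it to `0`, which may lie in `B`.
  have himg : (fun x : ℝ => (x : WithTop ℝ)) '' B = WithTop.untopD 0 ⁻¹' B ∩ {⊤}ᶜ := by
    ext y
    constructor
    · rintro ⟨x, hx, rfl⟩
      exact ⟨hx, WithTop.coe_ne_top⟩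
    · rintro ⟨h1, h2⟩
      obtain ⟨x, rfl⟩ := WithTop.ne_top_iff_exists.1 h2
      exact ⟨x, h1, rfl⟩
  have hm : Measurable fun ω => L (X ω) 0 T := (hL.measurable 0 T hT).comp hX.measurable
  rw [locationLaw, Measure.map_apply hm
    (himg ▸ (WithTop.measurable_untopD 0 hB).inter (measurableSet_singleton _).compl), himg]
  congr 1; ext ω
  simp [hL.ne_top _ _ _ hT]

end

theorem floor_div_min_eq {T t : ℝ} (hT : T ≤ 1) (ht : t ∈ Ioo 0 T) :
    ⌊(1 - T) / min t (T - t)⌋ = max ⌊(1 - T) / t⌋ ⌊(1 - T) / (T - t)⌋ := by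
  have h1 : 0 < T - t := by linarith [ht.2]
  rcases le_total t (T - t) with h | h
  · rw [min_eq_left h, max_eq_left]
    exact Int.floor_le_floor (div_le_div_of_nonneg_left (by linarith) ht.1 h)
  · rw [min_eq_right h, max_eq_right]
    exact Int.floor_le_floor (div_le_div_of_nonneg_left (by linarith) h1 h)

theorem invariantBound_eq {T t : ℝ} (hT : T ≤ 1) (ht : t ∈ Ioo 0 T) :
    invariantBound T t = (⌊(1 - T) / min t (T - t)⌋₊ : ℝ) + 2 := by
  have h1 : 0 < min t (T - t) := lt_min ht.1 (by linarith [ht.2])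
  have h2 : 0 ≤ (1 - T) / min t (T - t) := div_nonneg (by linarith) h1.le
  rw [invariantBound, ← floor_div_min_eq hT ht, natCast_floor_eq_intCast_floor h2]

theorem IsInvariantLocation.exists_isCadlagDensity {Ω : Type*} [MeasurableSpace Ω]
    {μ : Measure Ω} [IsProbabilityMeasure μ] {H : PathClass} {L : H.Path → ℝ → ℝ → WithTop ℝ}
    {X : Ω → H.Path} {T : ℝ} (hT₀ : 0 < T) (hT₁ : T ≤ 1) (hL : IsInvariantLocation H L)
    (hX : IsStationaryProcess μ H X) : ∃ f, IsCadlagDensity (locationLaw μ L X T) T f := by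
  have hl := hL.isLocationField hX
  obtain ⟨f, hf1, hf2, hf3⟩ := exists_cadlag_density μ (hl.measurable 0 T hT₀) hT₀
    (fun a b ha _ hb => hl.lipschitzOnWith_cdf hT₁ ha hb)
    (fun a b ha hab hb => hl.eVariationOn_difference_quotient_le ha hab hb)
  exact ⟨f, hf2, hf1, fun B hB hBT => by rw [hL.locationLaw_image hX hT₀ hB, ← hf3 B hB hBT]; rfl⟩

theorem IsInvariantLocation.density_le {Ω : Type*} [MeasurableSpace Ω]
    {μ : Measure Ω} [IsProbabilityMeasure μ] {H : PathClass} {L : H.Path → ℝ → ℝ → WithTop ℝ}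
    {X : Ω → H.Path} {T : ℝ} (hT₁ : T ≤ 1) (hL : IsInvariantLocation H L)
    (hX : IsStationaryProcess μ H X) {f : ℝ → ℝ} (hf : IsCadlagDensity (locationLaw μ L X T) T f)
    {t : ℝ} (ht : t ∈ Ioo 0 T) : f t ≤ invariantBound T t := by
  have hT₀ : 0 < T := ht.1.trans ht.2
  have hl := hL.isLocationField hX
  rw [invariantBound_eq hT₁ ht]
  set K := ⌊(1 - T) / min t (T - t)⌋₊ with hK
  refine le_of_setLIntegral_Ioc_le (hf.cadlag t ht).1 (by positivity) ?_
  have hd : 0 < min t (T - t) := lt_min ht.1 (by linarith [ht.2])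
  have hlim : Tendsto (fun N : ℕ => (1 : ℝ) / (N + 1)) atTop (𝓝 0) :=
    tendsto_one_div_add_atTop_nhds_zero_nat
  have hlim' : Tendsto (fun N : ℕ => (1 : ℝ) / (N + 1)) atTop (𝓝[>] 0) :=
    tendsto_nhdsWithin_iff.2 ⟨hlim, Eventually.of_forall fun N => by
      simp only [mem_Ioi]; positivity⟩
  refine hlim'.frequently (Eventually.frequently ?_)
  have hcont : Tendsto (fun N : ℕ => (1 - T) / min t (T - t - 1 / (N + 1))) atTop
      (𝓝 ((1 - T) / min t (T - t))) := by
    refine tendsto_const_nhds.div (tendsto_const_nhds.min ?_) hd.ne'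
    simpa using (tendsto_const_nhds (x := T - t)).sub hlim
  -- The floor is upper semicontinuous, so the count for small `δ` does not exceed `K`. The choice
  -- `δ = 1 / (N + 1)` fills the period exactly and loses no constant.
  have ev1 := hcont.eventually (gt_mem_nhds (Nat.lt_floor_add_one ((1 - T) / min t (T - t))))
  have ev2 := hlim.eventually (gt_mem_nhds (show (0 : ℝ) < T - t by linarith [ht.2]))
  filter_upwards [ev1, ev2] with N h1 h2
  set δ : ℝ := 1 / (N + 1) with hδ
  have hδ0 : 0 < δ := by positivity
  have hNδ : ((N + 1 : ℕ) : ℝ) * δ = 1 := by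
    push_cast; rw [hδ]; field_simp
  have h3 := hl.mul_measureReal_Ioc_le (N := N + 1) hT₁ ht.1 hδ0 (by linarith) hNδ.le
  have h4 : 0 ≤ (1 - T) / min t (T - t - δ) :=
    div_nonneg (by linarith) (le_min ht.1.le (by linarith))
  have h5 : ⌊(1 - T) / min t (T - t - δ)⌋₊ ≤ K := by
    rw [← Nat.lt_succ_iff, Nat.floor_lt h4]
    exact_mod_cast h1
  have h5 : (⌊(1 - T) / min t (T - t - δ)⌋₊ : ℝ) ≤ K := by exact_mod_cast h5
  rw [← hf.density _ measurableSet_Ioc fun s hs => ⟨ht.1.trans hs.1, by linarith [hs.2]⟩,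
    hL.locationLaw_image hX hT₀ measurableSet_Ioc, ← ofReal_measureReal]
  refine ENNReal.ofReal_le_ofReal ?_
  calc _ = δ * (((N + 1 : ℕ) : ℝ) * μ.real {ω | (L (X ω) 0 T).untopD 0 ∈ Ioc t (t + δ)}) := by
        rw [← mul_assoc, mul_comm δ, hNδ, one_mul]
    _ ≤ δ * (K + 2) := by gcongr; linarith
    _ = (K + 2) * δ := mul_comm _ _

/-- With `d = min t (T - t) ≤ T / 2`, the summand `2` is at most `T / d`, and `(1 - T) / d + T / d =
1 / d`. -/
theorem invariantBound_le {T t : ℝ} (hT : T ≤ 1) (ht : t ∈ Ioo 0 T) :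
    invariantBound T t ≤ max (1 / t) (1 / (T - t)) := by
  have h1 : 0 < T - t := by linarith [ht.2]
  have hd : 0 < min t (T - t) := lt_min ht.1 h1
  rw [invariantBound_eq hT ht]
  calc (⌊(1 - T) / min t (T - t)⌋₊ : ℝ) + 2 ≤ (1 - T) / min t (T - t) + T / min t (T - t) := by
        refine add_le_add (Nat.floor_le (div_nonneg (by linarith) hd.le)) ?_
        rw [le_div_iff₀ hd]
        linarith [min_le_left t (T - t), min_le_right t (T - t)]
    _ = 1 / min t (T - t) := by ring
    _ ≤ _ := by
        rcases min_choice t (T - t) with h | h <;> rw [h]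
        exacts [le_max_left _ _, le_max_right _ _]

/-! ### Leftmost points of highest priority -/

/-- The points of `[a, b]` where `p` is maximal over `[a, b]`. -/
def argmaxSet (p : ℝ → ℕ) (a b : ℝ) : Set ℝ := {x | x ∈ Icc a b ∧ ∀ y ∈ Icc a b, p y ≤ p x}

/-- The leftmost point of `[a, b]` where `p` is maximal over `[a, b]`. -/
noncomputable def firstArgmax (p : ℝ → ℕ) (a b : ℝ) : ℝ := sInf (argmaxSet p a b)

theorem isLeast_firstArgmax {p : ℝ → ℕ} (hp : ∀ k, IsClosed {x | k ≤ p x}) {m : ℕ}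
    (hm : ∀ x, p x ≤ m) {a b : ℝ} (hab : a < b) :
    IsLeast (argmaxSet p a b) (firstArgmax p a b) := by
  have hne : (p '' Icc a b).Nonempty := (nonempty_Icc.2 hab.le).image p
  have hbdd : BddAbove (p '' Icc a b) := ⟨m, by rintro _ ⟨x, _, rfl⟩; exact hm x⟩
  obtain ⟨x₀, hx₀, hx₀'⟩ := Nat.sSup_mem hne hbdd
  have hmax : ∀ y ∈ Icc a b, p y ≤ p x₀ := fun y hy => hx₀' ▸ le_csSup hbdd ⟨y, hy, rfl⟩
  have heq : argmaxSet p a b = Icc a b ∩ {x | p x₀ ≤ p x} := by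
    ext x
    exact ⟨fun h => ⟨h.1, h.2 x₀ hx₀⟩, fun h => ⟨h.1, fun y hy => (hmax y hy).trans h.2⟩⟩
  have hc : IsCompact (argmaxSet p a b) := heq ▸ isCompact_Icc.inter_right (hp _)
  exact hc.isLeast_sInf ⟨x₀, hx₀, hmax⟩

theorem firstArgmax_shift {p : ℝ → ℕ} (hp : ∀ k, IsClosed {x | k ≤ p x}) {m : ℕ}
    (hm : ∀ x, p x ≤ m) {a b : ℝ} (hab : a < b) (c : ℝ) :
    firstArgmax (fun x => p (x + c)) a b = firstArgmax p (a + c) (b + c) - c := by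
  have h1 := isLeast_firstArgmax (p := fun x => p (x + c))
    (fun k => (hp k).preimage (continuous_add_const c)) (fun x => hm _) hab
  have h2 := isLeast_firstArgmax hp hm (add_lt_add_left hab c)
  refine h1.unique ⟨⟨⟨?_, ?_⟩, fun y hy => ?_⟩, fun z hz => ?_⟩
  · linarith [h2.1.1.1]
  · linarith [h2.1.1.2]
  · simp only [sub_add_cancel]
    exact h2.1.2 _ ⟨by linarith [hy.1], by linarith [hy.2]⟩
  · have hz' : z + c ∈ argmaxSet p (a + c) (b + c) :=
      ⟨⟨by linarith [hz.1.1], by linarith [hz.1.2]⟩, fun y hy => by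
        simpa using hz.2 (y - c) ⟨by linarith [hy.1], by linarith [hy.2]⟩⟩
    linarith [h2.2 hz']

/-- Every unit interval meets `ρ + ℤ`, where alone the top value `m` is taken; this gives the
congruence modulo 1. -/
theorem isPeriodicLocation_firstArgmax {p : ℝ → ℕ} (hp : ∀ k, IsClosed {x | k ≤ p x}) {m : ℕ}
    (hm : ∀ x, p x ≤ m) (hper : Function.Periodic p 1) {ρ : ℝ}
    (hρ : ∀ x, p x = m ↔ ∃ n : ℤ, x = ρ + n) : IsPeriodicLocation (firstArgmax p) where
  mem a b hab := (isLeast_firstArgmax hp hm hab).1.1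
  stable a₁ b₁ a₂ b₂ h h1 h2 h3 := by
    have l1 := isLeast_firstArgmax hp hm (show a₁ < b₁ by linarith)
    have l2 := isLeast_firstArgmax hp hm h
    refine l2.unique ⟨⟨h3, fun y hy => l1.1.2 y ⟨by linarith [hy.1], by linarith [hy.2]⟩⟩,
      fun z hz => l1.2 ⟨⟨by linarith [hz.1.1], by linarith [hz.1.2]⟩, fun y hy => ?_⟩⟩
    exact (l1.1.2 y hy).trans (hz.2 _ h3)
  add_one a b hab := by
    have h1 := firstArgmax_shift hp hm hab 1
    have h2 : (fun x => p (x + 1)) = p := funext hper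
    rw [h2] at h1
    linarith
  mod_one a := by
    have key : ∀ a, ∃ n : ℤ, firstArgmax p a (a + 1) = ρ + n := fun a => by
      rw [← hρ]
      have h1 := isLeast_firstArgmax hp hm (lt_add_one a)
      refine le_antisymm (hm _) ?_
      rw [← (hρ (ρ + ⌈a - ρ⌉)).2 ⟨_, rfl⟩]
      exact h1.1.2 _ ⟨by linarith [Int.le_ceil (a - ρ)], by linarith [Int.ceil_lt_add_one (a - ρ)]⟩
    obtain ⟨n, hn⟩ := key a
    obtain ⟨k, hk⟩ := key 0
    rw [zero_add] at hk
    exact ⟨n - k, by push_cast; linarith⟩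

/-! ### Cosine paths with uniform phase -/

/-- A cosine path with phase `u`. -/
noncomputable def cosPath (u : UnitAddCircle) (x : ℝ) : ℝ :=
  ((AddCircle.toCircle ((x : UnitAddCircle) + u) : Circle) : ℂ).re

theorem continuous_cosPath_phase (x : ℝ) : Continuous fun u => cosPath u x :=
  Complex.continuous_re.comp (continuous_subtype_val.comp
    (AddCircle.continuous_toCircle.comp (continuous_const_add _)))

theorem continuous_cosPath (u : UnitAddCircle) : Continuous (cosPath u) :=
  Complex.continuous_re.comp (continuous_subtype_val.comp
    (AddCircle.continuous_toCircle.comp ((AddCircle.continuous_mk' 1).add continuous_const)))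

theorem cosPath_add (u : UnitAddCircle) (x c : ℝ) : cosPath u (x + c) = cosPath (u + c) x := by
  rw [cosPath, cosPath, AddCircle.coe_add, add_assoc, add_comm u]

/-- The two values are the real part and minus the imaginary part of the point on the unit circle.
-/
theorem injective_cosPath_eval : Function.Injective fun u => (cosPath u 0, cosPath u (1 / 4)) := by
  intro u v h
  simp only [Prod.mk.injEq, cosPath] at h
  obtain ⟨h1, h2⟩ := h
  have hI : ((AddCircle.toCircle (((1 / 4 : ℝ)) : UnitAddCircle) : Circle) : ℂ) = Complex.I := by
    rw [AddCircle.toCircle_apply_mk, Circle.coe_exp,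
      show ((2 * Real.pi / 1 * (1 / 4) : ℝ) : ℂ) = Real.pi / 2 by push_cast; ring,
      Complex.exp_pi_div_two_mul_I]
  rw [AddCircle.toCircle_add, AddCircle.toCircle_add, Circle.coe_mul, Circle.coe_mul, hI,
    Complex.I_mul_re, Complex.I_mul_re, neg_inj] at h2
  rw [AddCircle.coe_zero, zero_add, zero_add] at h1
  exact AddCircle.injective_toCircle one_ne_zero (Circle.ext (Complex.ext h1 h2))

/-- The class of all cosine paths of period `1` and amplitude `1`. -/
def cosPathClass : PathClass where
  carrier := range cosPath
  periodic := by
    rintro _ ⟨u, rfl⟩ x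
    rw [cosPath_add, AddCircle.coe_period, add_zero]
  shift_mem := by
    rintro _ ⟨u, rfl⟩ c
    exact ⟨u + c, funext fun x => (cosPath_add u x c).symm⟩

namespace cosPathClass

/-- The cosine path with phase `u`, as an element of the path class. -/
noncomputable def path (u : UnitAddCircle) : cosPathClass.Path := ⟨cosPath u, u, rfl⟩

/-- The phase of a cosine path. -/
noncomputable def phase (g : cosPathClass.Path) : UnitAddCircle := g.2.choose

theorem path_phase (g : cosPathClass.Path) : path (phase g) = g := Subtype.ext g.2.choose_spec

theorem injective_path : Function.Injective path := fun u v h => injective_cosPath_eval <| by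
  have : cosPath u = cosPath v := congrArg Subtype.val h
  simp [this]

theorem phase_path (u : UnitAddCircle) : phase (path u) = u := injective_path (path_phase _)

theorem shift_path (c : ℝ) (u : UnitAddCircle) : cosPathClass.shift c (path u) = path (u + c) :=
  Subtype.ext (funext fun x => cosPath_add u x c)

theorem phase_shift (c : ℝ) (g : cosPathClass.Path) :
    phase (cosPathClass.shift c g) = phase g + c := by
  rw [← path_phase g, shift_path, phase_path, phase_path]

/-- The phase is recovered from two coordinates by inverting a closed embedding of the compact
circle. -/
theorem measurable_phase : Measurable phase := by
  have h1 : Continuous fun u => (cosPath u 0, cosPath u (1 / 4)) :=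
    (continuous_cosPath_phase 0).prodMk (continuous_cosPath_phase (1 / 4))
  have h2 := (h1.isClosedEmbedding injective_cosPath_eval).measurableEmbedding
  rw [← h2.measurable_comp_iff]
  have h3 : (fun u => (cosPath u 0, cosPath u (1 / 4))) ∘ phase =
      fun g : cosPathClass.Path => (g.1 0, g.1 (1 / 4)) := by
    funext g
    have : cosPath (phase g) = g.1 := congrArg Subtype.val (path_phase g)
    simp [this]
  rw [h3]
  exact ((measurable_pi_apply 0).comp measurable_subtype_coe).prodMk
    ((measurable_pi_apply (1 / 4 : ℝ)).comp measurable_subtype_coe)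

theorem measurable_path : Measurable path :=
  (measurable_pi_lambda _ fun x => (continuous_cosPath_phase x).measurable).subtype_mk

theorem isStationaryProcess : IsStationaryProcess (volume : Measure UnitAddCircle) cosPathClass path
    where
  measurable := measurable_path
  stationary c := by
    have h1 : Measurable fun u => (path u).1 := measurable_subtype_coe.comp measurable_path
    have h2 : (fun u => fun t : ℝ => (path u).1 (t + c)) =
        (fun u => (path u).1) ∘ fun u : UnitAddCircle => u + (c : UnitAddCircle) := by
      funext u t
      exact cosPath_add u t c
    rw [h2, ← Measure.map_map h1 (measurable_add_const _),
      (measurePreserving_add_right volume (c : UnitAddCircle)).map_eq]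

variable {P : UnitAddCircle → ℕ} (hP : ∀ k, IsClosed {x | k ≤ P x}) {m : ℕ} (hm : ∀ x, P x ≤ m)

/-- The location functional that picks the leftmost point of highest priority `P`, where the
priorities are carried along by the phase of the path. -/
noncomputable def location (P : UnitAddCircle → ℕ) (g : cosPathClass.Path) (a b : ℝ) :
    WithTop ℝ :=
  (firstArgmax (fun x => P (x + phase g)) a b : ℝ)

include hP hm in
theorem isInvariantLocation_location (h0 : ∀ x, P x = m ↔ x = 0) :
    IsInvariantLocation cosPathClass (location P) := by
  have hP' : ∀ u : UnitAddCircle, ∀ k, IsClosed {x : ℝ | k ≤ P (x + u)} := fun u k =>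
    (hP k).preimage ((AddCircle.continuous_mk' 1).add continuous_const)
  have hloc : ∀ u : UnitAddCircle,
      IsPeriodicLocation (firstArgmax fun x => P ((x : UnitAddCircle) + u)) := by
    intro u
    obtain ⟨r, rfl⟩ := QuotientAddGroup.mk_surjective u
    refine isPeriodicLocation_firstArgmax (hP' _) (fun x => hm _) (fun x => by simp) (ρ := -r)
      fun x => ?_
    rw [h0]
    change (x : UnitAddCircle) + (r : UnitAddCircle) = 0 ↔ _
    rw [← AddCircle.coe_add, AddCircle.coe_eq_zero_iff]
    refine exists_congr fun n => ?_
    rw [zsmul_one]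
    constructor <;> intro h <;> linarith
  refine ⟨⟨fun a b hab => ?_, fun g a b hab => ?_, fun g a b c hab => ?_, ?_, ?_⟩, ?_, ?_⟩
  · refine Measurable.withTop_coe ?_
    suffices h : Measurable fun u : UnitAddCircle =>
        firstArgmax (fun x => P ((x : UnitAddCircle) + u)) a b from h.comp measurable_phase
    have hr : Measurable fun r : ℝ =>
        firstArgmax (fun x => P ((x : UnitAddCircle) + (r : UnitAddCircle))) a b := by
      have h1 : (fun r : ℝ =>
          firstArgmax (fun x => P ((x : UnitAddCircle) + (r : UnitAddCircle))) a b) =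
          fun r => firstArgmax (fun x => P ((x : UnitAddCircle) + 0)) (a + r) (b + r) - r := by
        funext r
        rw [← firstArgmax_shift (hP' 0) (fun x => hm _) hab r]
        simp
      rw [h1]
      -- Moving the phase amounts to moving the window, and the location is monotone in the window.
      refine Measurable.sub (Monotone.measurable fun r s hrs => ?_) measurable_id
      exact (hloc 0).mono (by linarith) (by linarith) (by linarith) (by linarith)
    have h2 := hr.comp (measurable_subtype_coe.comp (AddCircle.measurableEquivIoc 1 0).measurable)
    convert h2 using 2 with u
    have h3 : (((AddCircle.measurableEquivIoc 1 0 u : Ioc (0 : ℝ) (0 + 1)) : ℝ) :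
        UnitAddCircle) = u := AddCircle.coe_equivIoc
    simp only [Function.comp_apply, h3]
  · exact Or.inr ⟨_, (hloc (phase g)).mem a b hab, rfl⟩
  · rw [location, location, phase_shift, ← WithTop.coe_add, WithTop.coe_inj]
    have h1 := firstArgmax_shift (hP' (phase g)) (fun x => hm _) (sub_lt_sub_right hab c) c
    rw [sub_add_cancel, sub_add_cancel] at h1
    rw [← sub_eq_iff_eq_add, ← h1]
    congr 1
    funext x
    rw [AddCircle.coe_add, add_assoc, add_comm (c : UnitAddCircle)]
  · rintro g a₁ b₁ a₂ b₂ h h1 h2 ⟨x, hx, hx'⟩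
    rw [location, WithTop.coe_inj] at hx'
    rw [location, location, WithTop.coe_inj]
    exact (hloc (phase g)).stable a₁ b₁ a₂ b₂ h h1 h2 (hx' ▸ hx)
  · intro g _ _ _ _ _ _ _ _
    exact WithTop.coe_ne_top
  · intro g _ _ _
    exact WithTop.coe_ne_top
  · intro g a
    obtain ⟨n, hn⟩ := (hloc (phase g)).mod_one a
    exact ⟨n, by rw [location, location, ← WithTop.coe_add, WithTop.coe_inj, hn]⟩

end cosPathClass

/-! ### Marked points and sharpness -/

/-- The point `S i`, `i ≤ m`, of the circle has priority `m + 1 - i`, all other points have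
priority `0`. -/
noncomputable def listPriority (S : ℕ → ℝ) (m : ℕ) (x : UnitAddCircle) : ℕ :=
  open scoped Classical in
  (Finset.range (m + 1)).sup fun i => if (S i : UnitAddCircle) = x then m + 1 - i else 0

section listPriority

variable {S : ℕ → ℝ} {m : ℕ}

theorem le_listPriority {i : ℕ} (hi : i ≤ m) : m + 1 - i ≤ listPriority S m (S i) := by
  classical
  refine le_trans ?_ (Finset.le_sup (f := fun j => if (S j : UnitAddCircle) = S i then m + 1 - j
    else 0) (Finset.mem_range.2 (Nat.lt_succ_of_le hi)))
  simp

theorem exists_of_le_listPriority {k : ℕ} (hk : 0 < k) {x : UnitAddCircle}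
    (h : k ≤ listPriority S m x) : ∃ i, k + i ≤ m + 1 ∧ (S i : UnitAddCircle) = x := by
  classical
  obtain ⟨i, -, hi⟩ := Finset.exists_mem_eq_sup (Finset.range (m + 1)) ⟨0, by simp⟩
    fun i => if (S i : UnitAddCircle) = x then m + 1 - i else 0
  unfold listPriority at h
  rw [hi] at h
  split_ifs at h with h1
  · exact ⟨i, by omega, h1⟩
  · omega

theorem listPriority_le (x : UnitAddCircle) : listPriority S m x ≤ m + 1 := by
  classical
  refine Finset.sup_le fun i _ => ?_
  split_ifs <;> omega

theorem isClosed_le_listPriority (k : ℕ) : IsClosed {x | k ≤ listPriority S m x} := by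
  rcases Nat.eq_zero_or_pos k with rfl | hk
  · simp
  · refine Set.Finite.isClosed (((Finset.range (m + 2)).image
      fun i => (S i : UnitAddCircle)).finite_toSet.subset fun x hx => ?_)
    obtain ⟨i, hi, rfl⟩ := exists_of_le_listPriority hk hx
    simp only [Finset.coe_image, Finset.coe_range]
    exact ⟨i, by simp only [mem_Iio]; omega, rfl⟩

theorem listPriority_eq_max (h0 : S 0 = 0) (x : UnitAddCircle) :
    listPriority S m x = m + 1 ↔ x = 0 := by
  constructor
  · intro h
    obtain ⟨i, hi, rfl⟩ := exists_of_le_listPriority (Nat.succ_pos m) h.ge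
    obtain rfl : i = 0 := by omega
    rw [h0, AddCircle.coe_zero]
  · rintro rfl
    refine le_antisymm (listPriority_le _) ?_
    have := le_listPriority (S := S) (Nat.zero_le m)
    rwa [h0, AddCircle.coe_zero] at this

/-- By `hsep` no translate of a point of higher priority lies in the window, and since `T < 1` no
second translate of `S i` does. -/
theorem firstArgmax_listPriority {T t δ r : ℝ} (hT : T < 1) (ht : 0 < t)
    (hδ : t + δ < T) {i : ℕ} (hi : i ≤ m)
    (hsep : ∀ j < i, ∀ k : ℤ, S j + k - S i ∉ Icc (-(t + δ)) (T - t))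
    (hr : S i - r ∈ Ioc t (t + δ)) :
    firstArgmax (fun x => listPriority S m x) r (r + T) = S i := by
  have key : ∀ y ∈ Icc r (r + T), m + 1 - i ≤ listPriority S m y → y = S i := by
    intro y hy h
    obtain ⟨j, hj, hjy⟩ := exists_of_le_listPriority (by omega) h
    obtain ⟨n, hn⟩ := AddCircle.coe_eq_zero_iff 1 |>.1
      (show ((y - S j : ℝ) : UnitAddCircle) = 0 by rw [AddCircle.coe_sub, hjy, sub_self])
    rw [zsmul_one] at hn
    rcases (show j ≤ i by omega).lt_or_eq with hji | rfl
    · exact absurd (by constructor <;> linarith [hr.1, hr.2, hy.1, hy.2]) (hsep j hji n)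
    · have h1 : (n : ℝ) < 1 := by linarith [hr.1, hy.2]
      have h2 : (-1 : ℝ) < n := by linarith [hr.2, hy.1]
      have h1 : n < 1 := by exact_mod_cast h1
      have h2 : -1 < n := by exact_mod_cast h2
      obtain rfl : n = 0 := by omega
      push_cast at hn
      linarith
  have hmem : S i ∈ Icc r (r + T) := ⟨by linarith [hr.1], by linarith [hr.2]⟩
  have hl := isLeast_firstArgmax (p := fun x : ℝ => listPriority S m x)
    (fun k => (isClosed_le_listPriority k).preimage (AddCircle.continuous_mk' 1))
    (fun x => listPriority_le _) (show r < r + T by linarith [hr.1, hr.2])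
  exact key _ hl.1.1 ((le_listPriority hi).trans (hl.1.2 _ hmem))

end listPriority

/-- Each `S i` yields an interval of phases of length `δ` whose location lies in `(t, t + δ]`.
Separation makes these intervals disjoint, and `hβ` keeps them in one period, so their measures add
up on the circle. -/
theorem exists_le_density_of_separated {T t δ₀ β : ℝ} {S : ℕ → ℝ} {m : ℕ} (hT₁ : T < 1)
    (ht : t ∈ Ioo 0 T) (h0 : S 0 = 0) (hδ₀ : 0 < δ₀) (hδT : t + 2 * δ₀ < T)
    (hβ : ∀ i ≤ m, β ≤ S i - t - δ₀ ∧ S i - t ≤ β + 1)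
    (hsep : ∀ i ≤ m, ∀ j < i, ∀ k : ℤ, S j + k - S i ∉ Icc (-(t + δ₀)) (T - t)) :
    ∃ (Ω : Type) (_ : MeasurableSpace Ω) (μ : Measure Ω) (_ : IsProbabilityMeasure μ)
      (H : PathClass) (L : H.Path → ℝ → ℝ → WithTop ℝ) (X : Ω → H.Path),
      IsInvariantLocation H L ∧ IsStationaryProcess μ H X ∧ (∀ ω, Continuous (X ω).1) ∧
      ∀ f : ℝ → ℝ, IsCadlagDensity (locationLaw μ L X T) T f → (m + 1 : ℝ) ≤ f t := by
  have hT₀ : 0 < T := ht.1.trans ht.2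
  have hL : IsInvariantLocation cosPathClass (cosPathClass.location (listPriority S m)) :=
    cosPathClass.isInvariantLocation_location isClosed_le_listPriority listPriority_le
      (listPriority_eq_max h0)
  refine ⟨UnitAddCircle, inferInstance, volume, ⟨UnitAddCircle.measure_univ⟩, cosPathClass, _, cosPathClass.path,
    hL, cosPathClass.isStationaryProcess, continuous_cosPath, fun f hf => ?_⟩
  refine le_of_le_setLIntegral_Ioc (hf.cadlag t ht).1 (hf.nonneg t ht) (Eventually.frequently ?_)
  filter_upwards [Ioo_mem_nhdsGT hδ₀] with δ ⟨hδ, hδδ₀⟩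
  rw [← hf.density _ measurableSet_Ioc fun s hs => ⟨ht.1.trans hs.1, by linarith [hs.2]⟩,
    hL.locationLaw_image cosPathClass.isStationaryProcess hT₀ measurableSet_Ioc]
  set E : Set UnitAddCircle := {u | (cosPathClass.location (listPriority S m)
    (cosPathClass.path u) 0 T).untopD 0 ∈ Ioc t (t + δ)} with hE
  have hEm : MeasurableSet E :=
    (((hL.measurable 0 T hT₀).comp cosPathClass.measurable_path).untopD 0) measurableSet_Ioc
  have hsub : ∀ i ≤ m, ∀ r ∈ Ico (S i - t - δ) (S i - t), (r : UnitAddCircle) ∈ E := by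
    intro i hi r hr
    have h1 := firstArgmax_listPriority (δ := δ) (r := r) hT₁ ht.1 (by linarith) hi
      (fun j hj k hk => hsep i hi j hj k ⟨by linarith [hk.1], hk.2⟩)
      ⟨by linarith [hr.2], by linarith [hr.1]⟩
    have h2 := firstArgmax_shift (p := fun x : ℝ => listPriority S m x)
      (fun k => (isClosed_le_listPriority k).preimage (AddCircle.continuous_mk' 1))
      (fun x => listPriority_le _) hT₀ r
    rw [zero_add, add_comm T, h1] at h2
    simp only [hE, Set.mem_ofPred_eq, cosPathClass.location, cosPathClass.phase_path,
      WithTop.untopD_coe, ← AddCircle.coe_add]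
    rw [h2]
    exact ⟨by linarith [hr.2], by linarith [hr.1]⟩
  have hdisj : Set.PairwiseDisjoint (Finset.range (m + 1) : Set ℕ)
      fun i => Ico (S i - t - δ) (S i - t) := by
    have aux : ∀ i ≤ m, ∀ j < i, Disjoint (Ico (S i - t - δ) (S i - t))
        (Ico (S j - t - δ) (S j - t)) := by
      intro i hi j hj
      rw [Set.disjoint_left]
      intro r hr hr'
      refine hsep i hi j hj 0 ?_
      push_cast
      constructor <;> linarith [hr.1, hr.2, hr'.1, hr'.2, ht.1]
    intro i hi j hj hij
    simp only [Finset.coe_range, mem_Iio, Nat.lt_succ_iff] at hi hj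
    rcases lt_or_gt_of_ne hij with h | h
    · exact (aux j hj i h).symm
    · exact aux i hi j h
  calc ENNReal.ofReal ((m + 1 : ℝ) * δ)
      = ∑ i ∈ Finset.range (m + 1), volume (Ico (S i - t - δ) (S i - t)) := by
        simp only [Real.volume_Ico, sub_sub_cancel, Finset.sum_const, Finset.card_range]
        rw [nsmul_eq_mul, ENNReal.ofReal_mul (by positivity)]
        congr 1
        rw [← Nat.cast_succ, ENNReal.ofReal_natCast]
    _ = volume (⋃ i ∈ Finset.range (m + 1), Ico (S i - t - δ) (S i - t)) :=
        (measure_biUnion_finset hdisj fun _ _ => measurableSet_Ico).symm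
    _ ≤ volume (((↑) : ℝ → UnitAddCircle) ⁻¹' E ∩ Ioc β (β + 1)) := by
        refine measure_mono (iUnion₂_subset fun i hi r hr => ?_)
        have hi : i ≤ m := Nat.lt_succ_iff.1 (Finset.mem_range.1 hi)
        exact ⟨hsub i hi r hr, by linarith [(hβ i hi).1, hr.1],
          by linarith [(hβ i hi).2, hr.2]⟩
    _ = volume E := by
        rw [← (UnitAddCircle.measurePreserving_mk β).measure_preimage hEm.nullMeasurableSet,
          Measure.restrict_apply (AddCircle.measurable_mk' hEm)]

/-- Separated points with `⌊(1 - T) / d⌋ + 2` elements, where `d` is the distance from `t` to the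
boundary of `[0, T]`. -/
theorem exists_separated {T t : ℝ} {n : ℕ} (ht : t ∈ Ioo 0 T)
    (hn : n * min t (T - t) < 1 - T) :
    ∃ (S : ℕ → ℝ) (δ β : ℝ), S 0 = 0 ∧ 0 < δ ∧ t + 2 * δ < T ∧
      (∀ i ≤ n + 1, β ≤ S i - t - δ ∧ S i - t ≤ β + 1) ∧
      ∀ i ≤ n + 1, ∀ j < i, ∀ k : ℤ, S j + k - S i ∉ Icc (-(t + δ)) (T - t) := by
  obtain ⟨ht0, htT⟩ := ht
  set d := min t (T - t) with hd
  have hd0 : 0 < d := lt_min ht0 (by linarith)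
  -- The slack `1 - T - n * d` pays for widening the spacing from `d` to `d + 2 * δ`, with enough
  -- left to separate the points across the wrap-around (`htot`).
  set δ := min ((1 - T - n * d) / (4 * (n + 1))) (d / 4) with hδ
  have hδ0 : 0 < δ := lt_min (div_pos (by linarith) (by positivity)) (by linarith)
  have hδ1 : δ * (4 * (n + 1)) ≤ 1 - T - n * d := by
    rw [← le_div_iff₀ (by positivity)]; exact min_le_left _ _
  have hδ2 : δ ≤ d / 4 := min_le_right _ _
  have hdt : d ≤ t := min_le_left _ _
  have hdT : d ≤ T - t := min_le_right _ _
  set γ := d + 2 * δ with hγ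
  have hγ0 : 0 < γ := by linarith
  have hnδ : 0 ≤ n * δ := by positivity
  have htot : (n + 1) * γ + (T - d) + δ < 1 := by rw [hγ]; nlinarith
  have hi1 : ∀ {i : ℕ}, i ≤ n + 1 → i * γ ≤ (n + 1) * γ := fun h =>
    mul_le_mul_of_nonneg_right (by exact_mod_cast h) hγ0.le
  have hi0 : ∀ i : ℕ, 0 ≤ i * γ := fun i => by positivity
  have hij : ∀ {i j : ℕ}, j < i → j * γ + γ ≤ i * γ := fun {i j} h => by
    have : ((j : ℝ) + 1) * γ ≤ i * γ := mul_le_mul_of_nonneg_right (by exact_mod_cast h) hγ0.le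
    linarith
  have hk : ∀ k : ℤ, (k : ℝ) ≤ -1 ∨ (k : ℝ) = 0 ∨ 1 ≤ (k : ℝ) := fun k => by
    have : k ≤ -1 ∨ k = 0 ∨ 1 ≤ k := by omega
    exact_mod_cast this
  -- Higher priority points must escape through the nearer end of the window: the list runs
  -- rightwards if that is the left end, leftwards otherwise.
  rcases le_total t (T - t) with h | h
  · have hdeq : d = t := min_eq_left h
    refine ⟨fun i => i * γ, δ, -t - δ, by simp, hδ0, by linarith, fun i hi => ?_,
      fun i hi j hj k hmem => ?_⟩
    · have := hi0 i; have := hi1 hi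
      constructor <;> linarith
    · have h1 := hi0 j; have h2 := hi1 hi; have h3 := hij hj
      obtain ⟨h4, h5⟩ := hmem
      rcases hk k with h6 | h6 | h6 <;> linarith
  · have hdeq : d = T - t := min_eq_right h
    refine ⟨fun i => -(i * γ), δ, -((n + 1) * γ) - t - δ, by simp, hδ0, by linarith,
      fun i hi => ?_, fun i hi j hj k hmem => ?_⟩
    · have := hi0 i; have := hi1 hi
      constructor <;> linarith
    · have h1 := hi0 j; have h2 := hi1 hi; have h3 := hij hj
      obtain ⟨h4, h5⟩ := hmem
      rcases hk k with h6 | h6 | h6 <;> linarith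

theorem mainTheorem5 (T : ℝ) (hT₀ : 0 < T) (hT₁ : T ≤ 1) :
    -- the upper bound, for the càdlàg density (which exists)
    (∀ (Ω : Type*) [MeasurableSpace Ω] (μ : Measure Ω) [IsProbabilityMeasure μ]
        (H : PathClass) (L : H.Path → ℝ → ℝ → WithTop ℝ) (X : Ω → H.Path),
        IsInvariantLocation H L →
        IsStationaryProcess μ H X →
        (∀ ω, IsCadlagOn (X ω).1 univ) →
        (∃ f : ℝ → ℝ, IsCadlagDensity (locationLaw μ L X T) T f) ∧
        ∀ f : ℝ → ℝ, IsCadlagDensity (locationLaw μ L X T) T f →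
          ∀ t ∈ Ioo 0 T, f t ≤ invariantBound T t) ∧
    -- the bound is attained whenever the relevant ratio is not an integer
    (∀ t ∈ Ioo 0 T,
        (t < T / 2 → ¬ ∃ n : ℤ, (1 - T) / t = n) →
        (T / 2 ≤ t → ¬ ∃ n : ℤ, (1 - T) / (T - t) = n) →
        ∃ (Ω : Type) (_ : MeasurableSpace Ω) (μ : Measure Ω) (_ : IsProbabilityMeasure μ)
          (H : PathClass) (L : H.Path → ℝ → ℝ → WithTop ℝ) (X : Ω → H.Path),
          IsInvariantLocation H L ∧
          IsStationaryProcess μ H X ∧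
          (∀ ω, Continuous (X ω).1) ∧
          ∃ f : ℝ → ℝ, IsCadlagDensity (locationLaw μ L X T) T f ∧ f t = invariantBound T t) ∧
    -- the bound is never worse than the one for general stationary processes
    (∀ t ∈ Ioo 0 T, invariantBound T t ≤ max (1 / t) (1 / (T - t))) := by
  refine ⟨fun Ω _ μ _ H L X hL hX _ => ⟨hL.exists_isCadlagDensity hT₀ hT₁ hX,
    fun f hf t ht => hL.density_le hT₁ hX hf ht⟩, fun t ht h1 h2 => ?_,
    fun t ht => invariantBound_le hT₁ ht⟩
  have hd : 0 < min t (T - t) := lt_min ht.1 (by linarith [ht.2])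
  have hx : 0 ≤ (1 - T) / min t (T - t) := div_nonneg (by linarith) hd.le
  have hint : ¬ ∃ n : ℤ, (1 - T) / min t (T - t) = n := by
    rcases lt_or_ge t (T / 2) with h | h
    · rw [min_eq_left (by linarith)]
      exact h1 h
    · rw [min_eq_right (by linarith)]
      exact h2 h
  set n := ⌊(1 - T) / min t (T - t)⌋₊ with hn
  -- Non-integrality makes this strict; it also forces `T < 1`.
  have hlt : n * min t (T - t) < 1 - T := by
    rw [← lt_div_iff₀ hd]
    exact lt_of_le_of_ne (Nat.floor_le hx) fun h => hint ⟨n, by rw [← h]; simp⟩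
  have hT : T < 1 := by
    have : 0 ≤ n * min t (T - t) := by positivity
    linarith
  obtain ⟨S, δ, β, hS, hδ, hδT, hβ, hsep⟩ := exists_separated ht hlt
  obtain ⟨Ω, mΩ, μ, hμ, H, L, X, hL, hX, hc, hge⟩ :=
    exists_le_density_of_separated hT ht hS hδ hδT hβ hsep
  obtain ⟨f, hf⟩ := hL.exists_isCadlagDensity hT₀ hT₁ hX
  refine ⟨Ω, mΩ, μ, hμ, H, L, X, hL, hX, hc, f, hf, (hL.density_le hT₁ hX hf ht).antisymm ?_⟩
  rw [invariantBound_eq hT₁ ht]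
  have := hge f hf
  push_cast at this
  linarith
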